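/- Conventions. A function $f:X\to Y$ of metric spaces is a $(\lambda,\varepsilon)$-quasi-isometric embedding ($\lambda\ge 1$, $\varepsilon\ge 0$) if $\frac1\lambda d(x,x')-\varepsilon\le d(f(x),f(x'))\le\lambda d(x,x')+\varepsilon$ for all $x,x'$. It is a quasi-isometry if it is such an embedding for some $\lambda,\varepsilon$ and there are $\hat f:Y\to X$ and $D\ge 0$ with $d(\hat f f(x),x)\le D$ and $d(f\hat f(y),y)\le D$ for all $x,y$. A $(\lambda,\varepsilon)$-quasi-geodesic is a $(\lambda,\varepsilon)$-quasi-isometric embedding of a closed interval; a geodesic is a $(1,0)$-quasi-geodesic. A Morse gauge is a function $N:[1,\infty)\times[0,\infty)\to[0,\infty)$. A geodesic $\gamma$ is $N$-Morse if every finite $(\lambda,\varepsilon)$-quasi-geodesic with endpoints on $\gamma$ lies in the (closed) $N(\lambda,\varepsilon)$-neighbourhood of $\gamma$. Two (quasi-)geodesics are asymptotic if their images have finite Hausdorff distance. Morse boundary. Let $X$ be a proper geodesic metric space and $p\in X$. Let $\partial_vX_p$ be the set of asymptoty classes of geodesic rays based at $p$. A subset $B$ of it is closed iff, whenever $\beta_n$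 are rays with $[\beta_n]\in B$ and $b\in\partial_vX_p$ is such that every subsequence of $(\beta_n)$ has a subsequence converging uniformly on compact sets to a ray in $b$, then $b\in B$. Let $\partial^NX_p\subseteq\partial_vX_p$ be the set of classes containing an $N$-Morse ray, with the subspace topology. The Morse boundary is $\partial X=\bigcup_N\partial^NX_p$ with the direct limit topology (the finest topology making all inclusions $\partial^NX_p\to\partial X$ continuous). A bi-infinite geodesic is from $a\in\partial X$ to $b\in\partial X$ if its restrictions to $(-\infty,0]$ and $[0,\infty)$ are asymptotic to representatives of $a$ and $b$ respectively. In the rest, a bi-infinite geodesic is called $N$-Morse only if $N$ is also a gauge for all its subgeodesics. Let $\partial X^{(n,N)}$ be the set of $n$-tuples of pairwise distinct points of $\partial X$ such that every geodesic between any two of them is $N$-Morse. For $K>0$ let $m_X^{K}(a,b,c)$ be the set of points of $X$ lying within $K$ of all three sides of some ideal geodesic triangle with vertices $a,b,c$. Call $K>0$ admissible for $(X,N)$ if every ideal geodesic triangle in $X$ with $N$-Morse sides has points, one on each side, that are pairwise at distance at most $K$. For each $N$ let $K_N$ be an admissible constant for $(X,N)$ (one exists, as part of the theorem), and define the $N$-cross-ratio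 $$[a,b,c,d]_N=\operatorname{diam}\bigl(m_X^{K_N}(a,b,c)\cup m_X^{K_N}(a,d,c)\bigr),\qquad (a,b,c,d)\in\partial X^{(4,N)}.$$ A map $h:\partial X\to\partial Y$ is 2-stable if for every $N$ there is $N'$ with $h(\partial X^{(2,N)})\subseteq\partial Y^{(2,N')}$. A 2-stable map $h$ is quasi-möbius if for all gauges $N,N'$ with $h(\partial X^{(2,N)})\subseteq\partial Y^{(2,N')}$ there is a continuous increasing $\psi:[0,\infty)\to[0,\infty)$ such that for all $(a,b,c,d)\in\partial X^{(4,N)}$ both cross-ratios below are finite and $$[h(a),h(b),h(c),h(d)]_{N'}\le\psi([a,b,c,d]_N).$$ Theorem. Let $f:X\to Y$ be a quasi-isometry between proper geodesic metric spaces, with basepoints $p\in X$, $q\in Y$ (for instance $q=f(p)$). Then admissible constants exist for every gauge, in $X$ and in $Y$, and $f$ induces a homeomorphism $f_*:\partial X\to\partial Y$ of the Morse boundaries based at $p$ and $q$: for every geodesic ray $\alpha$ based at $p$ with class $a\in\partial X$, $f(\alpha)$ is at finite Hausdorff distance from every geodesic ray based at $q$ in the class $f_*(a)$. Both $f_*$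 and its inverse are 2-stable and quasi-möbius, whatever admissible constants are used to form the cross-ratios. -/

import Mathlib

open scoped NNReal ENNReal

namespace MorseGeometry

/-! Coarse geometry -/

/-- A metric space is geodesic if any two points are joined by an isometrically embedded
compact interval. -/
def IsGeodesicSpace (X : Type*) [MetricSpace X] : Prop :=
  ∀ x y : X, ∃ γ : ℝ → X, γ 0 = x ∧ γ (dist x y) = y ∧
    ∀ s ∈ Set.Icc 0 (dist x y), ∀ t ∈ Set.Icc 0 (dist x y), dist (γ s) (γ t) = |s - t|

/-- `f` restricted to `S` is a `(l, e)`-quasi-isometric embedding. -/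
def IsQIEmbeddingOn {A X : Type*} [MetricSpace A] [MetricSpace X]
    (l e : ℝ) (f : A → X) (S : Set A) : Prop :=
  ∀ s ∈ S, ∀ t ∈ S,
    1 / l * dist s t - e ≤ dist (f s) (f t) ∧ dist (f s) (f t) ≤ l * dist s t + e

/-- A quasi-isometry is a quasi-isometric embedding that has a quasi-inverse. -/
def IsQuasiIsometry {X Y : Type*} [MetricSpace X] [MetricSpace Y] (f : X → Y) : Prop :=
  (∃ l e : ℝ, 1 ≤ l ∧ 0 ≤ e ∧ IsQIEmbeddingOn l e f Set.univ) ∧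
  ∃ (g : Y → X) (D : ℝ), 0 ≤ D ∧ (∀ x, dist (g (f x)) x ≤ D) ∧ ∀ y, dist (f (g y)) y ≤ D

/-- Two subsets are asymptotic if their Hausdorff distance is finite. -/
def Asymptotic {X : Type*} [MetricSpace X] (A B : Set X) : Prop :=
  Metric.hausdorffEDist A B ≠ ⊤

/-- Morse gauges: functions `[1, ∞) × [0, ∞) → [0, ∞)`. -/
abbrev MorseGauge : Type := Set.Ici (1 : ℝ) → ℝ≥0 → ℝ≥0

/-- The set `A` (the image of a geodesic) is `N`-Morse: every finite `(l, e)`-quasi-geodesic with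
both endpoints on `A` is contained in the `N(l, e)`-neighbourhood of `A`. -/
def IsMorse {X : Type*} [MetricSpace X] (N : MorseGauge) (A : Set X) : Prop :=
  ∀ (l : Set.Ici (1 : ℝ)) (e : ℝ≥0) (a b : ℝ) (σ : ℝ → X), a ≤ b →
    IsQIEmbeddingOn (l : ℝ) (e : ℝ) σ (Set.Icc a b) → σ a ∈ A → σ b ∈ A →
    ∀ t ∈ Set.Icc a b, ∃ y ∈ A, dist (σ t) y ≤ N l e

/-! The Morse boundary -/

/-- Geodesic rays based at `p`. -/
def Ray {X : Type*} [MetricSpace X] (p : X) : Type _ :=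
  {γ : ℝ≥0 → X // Isometry γ ∧ γ 0 = p}

/-- The image of a geodesic ray. -/
def Ray.image {X : Type*} [MetricSpace X] {p : X} (α : Ray p) : Set X := Set.range α.1

/-- Being asymptotic is an equivalence relation on the geodesic rays based at `p`. -/
instance raySetoid {X : Type*} [MetricSpace X] (p : X) : Setoid (Ray p) where
  r α β := Asymptotic α.image β.image
  iseqv :=
    { refl := fun α => by simp [Asymptotic]
      symm := fun {α β} h => by
        unfold Asymptotic at h ⊢
        rwa [Metric.hausdorffEDist_comm]
      trans := fun {α β γ} h h' => by
        unfold Asymptotic at h h' ⊢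
        exact ne_top_of_le_ne_top (ENNReal.add_ne_top.2 ⟨h, h'⟩)
          Metric.hausdorffEDist_triangle }

/-- The set of asymptoty classes of geodesic rays based at `p`. -/
def VisualBoundary {X : Type*} [MetricSpace X] (p : X) : Type _ := Quotient (raySetoid p)

/-- The class of a geodesic ray. -/
def Ray.cls {X : Type*} [MetricSpace X] {p : X} (α : Ray p) : VisualBoundary p :=
  Quotient.mk (raySetoid p) α

/-- Uniform convergence on compact sets of a sequence of geodesic rays. -/
def RayTendsto {X : Type*} [MetricSpace X] {p : X} (β : ℕ → Ray p) (γ : Ray p) : Prop :=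
  ∀ C : Set ℝ≥0, IsCompact C →
    TendstoUniformlyOn (fun n t => (β n).1 t) γ.1 Filter.atTop C

/-- Every subsequence of `β` has a further subsequence converging uniformly on compact sets to
some ray in the class `b`. -/
def SubconvergesTo {X : Type*} [MetricSpace X] {p : X} (β : ℕ → Ray p)
    (b : VisualBoundary p) : Prop :=
  ∀ φ : ℕ → ℕ, StrictMono φ → ∃ ψ : ℕ → ℕ, StrictMono ψ ∧
    ∃ γ : Ray p, γ.cls = b ∧ RayTendsto (fun n => β (φ (ψ n))) γ

/-- The sets that are declared closed in the visual boundary. -/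
def IsVisuallyClosed {X : Type*} [MetricSpace X] {p : X} (B : Set (VisualBoundary p)) : Prop :=
  ∀ (β : ℕ → Ray p) (b : VisualBoundary p),
    (∀ n, (β n).cls ∈ B) → SubconvergesTo β b → b ∈ B

theorem SubconvergesTo.comp {X : Type*} [MetricSpace X] {p : X} {β : ℕ → Ray p}
    {b : VisualBoundary p} (h : SubconvergesTo β b) {θ : ℕ → ℕ} (hθ : StrictMono θ) :
    SubconvergesTo (fun n => β (θ n)) b :=
  fun φ hφ => h (θ ∘ φ) (hθ.comp hφ)

/-- The topology on the visual boundary whose closed sets are the visually closed ones. -/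
instance {X : Type*} [MetricSpace X] (p : X) : TopologicalSpace (VisualBoundary p) :=
  TopologicalSpace.ofClosed {B | IsVisuallyClosed B}
    (fun _ _ h _ => (h 0).elim)
    (fun A hA β b hβ hb B hB =>
      hA hB β b (fun n => hβ n B hB) hb)
    (fun A hA B hB β b hβ hb => by
      by_cases h : ∃ᶠ n in Filter.atTop, (β n).cls ∈ A
      · obtain ⟨θ, hθ, hθA⟩ := Filter.extraction_of_frequently_atTop h
        exact Or.inl (hA _ b hθA (hb.comp hθ))
      · have h' : ∃ᶠ n in Filter.atTop, (β n).cls ∈ B :=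
          ((Filter.not_frequently.1 h).mono fun n hn =>
            (hβ n).resolve_left hn).frequently
        obtain ⟨θ, hθ, hθB⟩ := Filter.extraction_of_frequently_atTop h'
        exact Or.inr (hB _ b hθB (hb.comp hθ)))

/-- The stratum of the classes that contain an `N`-Morse geodesic ray. It carries the subspace
topology. -/
def stratum {X : Type*} [MetricSpace X] (p : X) (N : MorseGauge) : Set (VisualBoundary p) :=
  {a | ∃ α : Ray p, α.cls = a ∧ IsMorse N α.image}

/-- The Morse boundary (as a set): the union of all strata. -/
def MorseBoundary {X : Type*} [MetricSpace X] (p : X) : Type _ :=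
  {a : VisualBoundary p // ∃ N : MorseGauge, a ∈ stratum p N}

/-- The inclusion of a stratum into the Morse boundary. -/
def stratumInclusion {X : Type*} [MetricSpace X] (p : X) (N : MorseGauge) :
    stratum p N → MorseBoundary p :=
  fun a => ⟨a.1, N, a.2⟩

/-- The direct limit topology: the finest topology for which the inclusions of all strata are
continuous. -/
instance {X : Type*} [MetricSpace X] (p : X) : TopologicalSpace (MorseBoundary p) :=
  ⨆ N : MorseGauge,
    TopologicalSpace.coinduced (stratumInclusion p N) (inferInstance : TopologicalSpace (stratum p N))

/-- The map `h` between Morse boundaries is induced by `f`: the image under `f` of any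
geodesic ray in the class `a` is asymptotic to any geodesic ray in the class `h a`. -/
def IsInducedBy {X Y : Type*} [MetricSpace X] [MetricSpace Y] {p : X} {q : Y}
    (f : X → Y) (h : MorseBoundary p → MorseBoundary q) : Prop :=
  ∀ (a : MorseBoundary p) (α : Ray p) (β : Ray q),
    α.cls = a.1 → β.cls = (h a).1 → Asymptotic (f '' α.image) β.image

/-! Ideal triangles and their centers -/

/-- `γ` is a bi-infinite geodesic from `a` to `b`. -/
def IsLineFromTo {X : Type*} [MetricSpace X] {p : X} (γ : ℝ → X) (a b : MorseBoundary p) : Prop :=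
  Isometry γ ∧
  (∃ α : Ray p, α.cls = a.1 ∧ Asymptotic (γ '' Set.Iic 0) α.image) ∧
  ∃ β : Ray p, β.cls = b.1 ∧ Asymptotic (γ '' Set.Ici 0) β.image

/-- The bi-infinite geodesic `γ` is `N`-Morse, with the convention that the gauge also works for
all subgeodesics of `γ` (restrictions of `γ` to closed intervals, including `γ` itself). -/
def IsMorseLine {X : Type*} [MetricSpace X] (N : MorseGauge) (γ : ℝ → X) : Prop :=
  ∀ J : Set ℝ, IsClosed J → J.OrdConnected → IsMorse N (γ '' J)

/-- The `n`-tuples of pairwise distinct points of the Morse boundary such that every geodesic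
between any two points of the tuple is `N`-Morse. -/
def morseTuples {X : Type*} [MetricSpace X] (p : X) (n : ℕ) (N : MorseGauge) :
    Set (Fin n → MorseBoundary p) :=
  {t | Function.Injective t ∧
    ∀ i j, i ≠ j → ∀ γ : ℝ → X, IsLineFromTo γ (t i) (t j) → IsMorseLine N γ}

/-- The geodesics `γ₁, γ₂, γ₃` are the sides of an ideal triangle with vertices `a, b, c`. -/
def IsIdealTriangle {X : Type*} [MetricSpace X] {p : X} (a b c : MorseBoundary p)
    (γ₁ γ₂ γ₃ : ℝ → X) : Prop :=
  IsLineFromTo γ₁ a b ∧ IsLineFromTo γ₂ b c ∧ IsLineFromTo γ₃ a c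

/-- The `K`-centers of `(a, b, c)`: the points within `K` of all sides of some ideal geodesic
triangle with vertices `a, b, c`. -/
def centers {X : Type*} [MetricSpace X] {p : X} (K : ℝ) (a b c : MorseBoundary p) : Set X :=
  {x | ∃ γ₁ γ₂ γ₃ : ℝ → X, IsIdealTriangle a b c γ₁ γ₂ γ₃ ∧
    (∃ t, dist x (γ₁ t) ≤ K) ∧ (∃ t, dist x (γ₂ t) ≤ K) ∧ ∃ t, dist x (γ₃ t) ≤ K}

/-- `K` is an admissible constant for the gauge `N`: every ideal geodesic triangle with `N`-Morse
sides has a `K`-internal triple, that is, three points, one on each side, that are pairwise at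
distance at most `K`. -/
def IsInternalConstant {X : Type*} [MetricSpace X] (p : X) (N : MorseGauge) (K : ℝ) : Prop :=
  0 < K ∧ ∀ (a b c : MorseBoundary p) (γ₁ γ₂ γ₃ : ℝ → X), IsIdealTriangle a b c γ₁ γ₂ γ₃ →
    IsMorseLine N γ₁ → IsMorseLine N γ₂ → IsMorseLine N γ₃ →
    ∃ t₁ t₂ t₃ : ℝ, dist (γ₁ t₁) (γ₂ t₂) ≤ K ∧ dist (γ₂ t₂) (γ₃ t₃) ≤ K ∧
      dist (γ₁ t₁) (γ₃ t₃) ≤ K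

/-- The cross-ratio of four boundary points, formed with `K`-centers; a priori in `[0, ∞]`. -/
noncomputable def crossRatio {X : Type*} [MetricSpace X] {p : X} (K : ℝ)
    (a b c d : MorseBoundary p) : ℝ≥0∞ :=
  Metric.ediam (centers K a b c ∪ centers K a d c)

/-! Maps between Morse boundaries -/

/-- `h` maps the pairs joined by `N`-Morse geodesics to pairs joined by `N'`-Morse geodesics. -/
def MapsMorsePairs {X Y : Type*} [MetricSpace X] [MetricSpace Y] {p : X} {q : Y}
    (h : MorseBoundary p → MorseBoundary q) (N N' : MorseGauge) : Prop :=
  ∀ t ∈ morseTuples p 2 N, h ∘ t ∈ morseTuples q 2 N'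

/-- 2-stable maps. -/
def IsTwoStable {X Y : Type*} [MetricSpace X] [MetricSpace Y] {p : X} {q : Y}
    (h : MorseBoundary p → MorseBoundary q) : Prop :=
  ∀ N : MorseGauge, ∃ N' : MorseGauge, MapsMorsePairs h N N'

/-- Quasi-möbius maps: the cross-ratios involved are finite, and those of the image points are
controlled by those of the original points. The cross-ratios for the gauges `N` and `N'` are formed
with admissible constants `K` and `K'`, and the condition is asked for all choices of those. -/
def IsQuasiMobius {X Y : Type*} [MetricSpace X] [MetricSpace Y] {p : X} {q : Y}
    (h : MorseBoundary p → MorseBoundary q) : Prop :=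
  ∀ N N' : MorseGauge, MapsMorsePairs h N N' →
    ∀ K K' : ℝ, IsInternalConstant p N K → IsInternalConstant q N' K' →
      ∃ ψ : ℝ≥0 → ℝ≥0, Continuous ψ ∧ StrictMono ψ ∧
        ∀ t ∈ morseTuples p 4 N, ∃ r s : ℝ≥0,
          crossRatio K (t 0) (t 1) (t 2) (t 3) = r ∧
          crossRatio K' (h (t 0)) (h (t 1)) (h (t 2)) (h (t 3)) = s ∧
          s ≤ ψ r

end MorseGeometry

open MorseGeometry

namespace MorseGeometry

/-! Everything rests on bounds that depend only on the Morse gauge. The basic device is surgery: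
join a point to a geodesic by a shortest segment, then follow the geodesic. The result is a
(3,0)-quasi-geodesic, however long the segment is. So a geodesic that comes within some uncontrolled
distance D of a Morse set at both ends is, away from its ends, within a distance C of the set that
does not depend on D (`exists_bound_of_two_ends`, `exists_bound_of_one_end`,
`exists_bound_of_nearest`). Mere asymptoticity thereby becomes uniform closeness.

Quasi-isometries preserve Morse sets. Segments from q to far points of the image of a Morse ray stay
near this image and subconverge by Arzelà–Ascoli, so the image is uniformly close to a Morse ray
(`IsQuasiIsometry.exists_ray`). This defines the boundary map, and a quasi-inverse induces its
inverse. For continuity on a stratum, the N-Morse rays are enlarged to their limits: these share one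
gauge M, and their classes form a visually closed set. Their images lie in a single stratum of the
target, where uniform closeness passes to limits (`IsInducedBy.continuous`).

Distinct Morse points are joined by a line (`exists_isLineFromTo`), and any line joining the image
points is uniformly close to the image of a Morse line joining the original points; this gives
2-stability. Two points near all three sides of an ideal triangle with Morse sides are uniformly
close (`exists_dist_le_of_near_sides`). Hence f sends centers to within a constant C of all centers
of the image triple, and an (l, e)-quasi-isometry changes the cross-ratio at most by the affine
function r ↦ l r + e + 2C. -/

/-- `γ` restricted to `J` is an isometric embedding. -/
def IsGeodesicOn {X : Type*} [MetricSpace X] (γ : ℝ → X) (J : Set ℝ) : Prop :=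
  ∀ s ∈ J, ∀ t ∈ J, dist (γ s) (γ t) = |s - t|

/-- `σ` restricted to `S` is `1`-Lipschitz and contracts distances by a factor at most `l`. -/
def IsTameOn {X : Type*} [MetricSpace X] (l : ℝ) (σ : ℝ → X) (S : Set ℝ) : Prop :=
  ∀ s ∈ S, ∀ t ∈ S, s ≤ t → t - s ≤ l * dist (σ s) (σ t) ∧ dist (σ s) (σ t) ≤ t - s

/-! ### Tame paths, nearest points, Morse bounds and coarse continuity -/

section Basic

variable {X : Type*} [MetricSpace X]

theorem IsGeodesicOn.mono {γ : ℝ → X} {J J' : Set ℝ} (h : IsGeodesicOn γ J) (hJ : J' ⊆ J) :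
    IsGeodesicOn γ J' := fun s hs t ht => h s (hJ hs) t (hJ ht)

theorem IsGeodesicOn.dist_of_le {γ : ℝ → X} {J : Set ℝ} (h : IsGeodesicOn γ J) {s t : ℝ}
    (hs : s ∈ J) (ht : t ∈ J) (hst : s ≤ t) : dist (γ s) (γ t) = t - s := by
  rw [h s hs t ht, abs_sub_comm, abs_of_nonneg (by linarith)]

theorem isGeodesicOn_of_isometry {γ : ℝ → X} (h : Isometry γ) (J : Set ℝ) : IsGeodesicOn γ J :=
  fun s _ t _ => by rw [h.dist_eq, Real.dist_eq]

theorem IsGeodesicOn.isTameOn {γ : ℝ → X} {J : Set ℝ} (h : IsGeodesicOn γ J) {l : ℝ} (hl : 1 ≤ l) :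
    IsTameOn l γ J := fun s hs t ht hst => by
  rw [h.dist_of_le hs ht hst]
  exact ⟨by nlinarith, le_rfl⟩

theorem IsGeodesicOn.isQIEmbeddingOn {γ : ℝ → X} {J : Set ℝ} (h : IsGeodesicOn γ J) :
    IsQIEmbeddingOn 1 0 γ J := fun s hs t ht => by
  rw [h s hs t ht, Real.dist_eq]
  constructor <;> linarith

theorem IsTameOn.isQIEmbeddingOn {σ : ℝ → X} {S : Set ℝ} {l : ℝ} (hl : 1 ≤ l)
    (h : IsTameOn l σ S) : IsQIEmbeddingOn l 0 σ S := by
  have key : ∀ s ∈ S, ∀ t ∈ S, s ≤ t →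
      1 / l * dist s t - 0 ≤ dist (σ s) (σ t) ∧ dist (σ s) (σ t) ≤ l * dist s t + 0 := by
    intro s hs t ht hst
    obtain ⟨h1, h2⟩ := h s hs t ht hst
    have hd : dist s t = t - s := by
      rw [Real.dist_eq, abs_sub_comm, abs_of_nonneg (by linarith)]
    rw [hd]
    refine ⟨?_, by nlinarith⟩
    rw [sub_zero, one_div, inv_mul_le_iff₀ (by linarith)]
    exact h1
  intro s hs t ht
  rcases le_total s t with hst | hst
  · exact key s hs t ht hst
  · rw [dist_comm s t, dist_comm (σ s)]
    exact key t ht s hs hst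

/-- A concatenation of tame paths is tame if points on different pieces are far apart. -/
theorem IsTameOn.glue {f g : ℝ → X} {l a b c : ℝ} (hf : IsTameOn l f (Set.Icc a b))
    (hg : IsTameOn l g (Set.Icc b c)) (hfg : f b = g b)
    (hl : ∀ s ∈ Set.Icc a b, ∀ t ∈ Set.Icc b c, t - s ≤ l * dist (f s) (g t)) :
    IsTameOn l (fun t => if t ≤ b then f t else g t) (Set.Icc a c) := by
  intro s hs t ht hst
  by_cases h1 : t ≤ b
  · have h2 : s ≤ b := hst.trans h1
    simp only [h1, h2, if_true]
    exact hf s ⟨hs.1, h2⟩ t ⟨ht.1, h1⟩ hst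
  · push Not at h1
    by_cases h2 : s ≤ b
    · simp only [h1.not_ge, h2, if_true, if_false]
      refine ⟨hl s ⟨hs.1, h2⟩ t ⟨h1.le, ht.2⟩, ?_⟩
      have e1 := (hf s ⟨hs.1, h2⟩ b ⟨hs.1.trans h2, le_rfl⟩ h2).2
      have e2 := (hg b ⟨le_rfl, h1.le.trans ht.2⟩ t ⟨h1.le, ht.2⟩ h1.le).2
      rw [hfg] at e1
      linarith [dist_triangle (f s) (g b) (g t)]
    · push Not at h2
      simp only [h1.not_ge, h2.not_ge, if_false]
      exact hg s ⟨h2.le, hs.2⟩ t ⟨h1.le, ht.2⟩ hst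

/-- Put δ = d(c s, γ t). Since γ b is nearest to c a, it is also nearest to c s on the geodesic from
c a to γ b, so d(c s, γ b) ≤ δ. Then d(γ b, γ t) ≤ 2δ, and the two legs add up to at most 3δ. This
is the source of the factor 3 in all surgeries. -/
theorem sub_le_three_mul_dist_of_nearest_left {c γ : ℝ → X} {a b s t : ℝ} {J : Set ℝ}
    (hc : IsGeodesicOn c (Set.Icc a b)) (hγ : IsGeodesicOn γ J) (hbJ : b ∈ J) (hb : c b = γ b)
    (hn : ∀ t ∈ J, dist (c a) (γ b) ≤ dist (c a) (γ t))
    (hs : s ∈ Set.Icc a b) (ht : t ∈ J) (hbt : b ≤ t) : t - s ≤ 3 * dist (c s) (γ t) := by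
  have hab : a ≤ b := hs.1.trans hs.2
  have e1 := hc.dist_of_le ⟨le_rfl, hab⟩ hs hs.1
  have e2 := hc.dist_of_le hs ⟨hab, le_rfl⟩ hs.2
  have e3 := hc.dist_of_le ⟨le_rfl, hab⟩ ⟨hab, le_rfl⟩ hab
  have e4 := hγ.dist_of_le hbJ ht hbt
  have e5 := hn t ht
  rw [hb] at e2 e3
  have t1 := dist_triangle (c a) (c s) (γ t)
  have t2 := dist_triangle (γ b) (c s) (γ t)
  rw [dist_comm (γ b) (c s)] at t2
  linarith

theorem sub_le_three_mul_dist_of_nearest_right {c γ : ℝ → X} {a b s t : ℝ} {J : Set ℝ}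
    (hc : IsGeodesicOn c (Set.Icc a b)) (hγ : IsGeodesicOn γ J) (haJ : a ∈ J) (ha : c a = γ a)
    (hn : ∀ t ∈ J, dist (c b) (γ a) ≤ dist (c b) (γ t))
    (hs : s ∈ J) (hsa : s ≤ a) (ht : t ∈ Set.Icc a b) : t - s ≤ 3 * dist (γ s) (c t) := by
  have hab : a ≤ b := ht.1.trans ht.2
  have e1 := hc.dist_of_le ht ⟨hab, le_rfl⟩ ht.2
  have e2 := hc.dist_of_le ⟨le_rfl, hab⟩ ht ht.1
  have e3 := hc.dist_of_le ⟨le_rfl, hab⟩ ⟨hab, le_rfl⟩ hab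
  have e4 := hγ.dist_of_le hs haJ hsa
  have e5 := hn s hs
  rw [ha] at e2 e3
  have t1 := dist_triangle (c b) (c t) (γ s)
  have t2 := dist_triangle (γ s) (c t) (γ a)
  rw [dist_comm (c b) (γ a)] at e5
  rw [dist_comm (c b) (c t), dist_comm (c t) (γ s)] at t1
  rw [dist_comm (c t) (γ a)] at t2
  linarith

/-- A geodesic space has a geodesic between any two points on any interval of the right length. -/
theorem IsGeodesicSpace.exists_segment (hX : IsGeodesicSpace X) (x y : X) (a : ℝ) :
    ∃ c : ℝ → X, c a = x ∧ c (a + dist x y) = y ∧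
      IsGeodesicOn c (Set.Icc a (a + dist x y)) := by
  obtain ⟨γ, h0, h1, h⟩ := hX x y
  refine ⟨fun t => γ (t - a), by simpa using h0, by simpa using h1, fun s hs t ht => ?_⟩
  rw [h (s - a) ⟨by linarith [hs.1], by linarith [hs.2]⟩ (t - a)
    ⟨by linarith [ht.1], by linarith [ht.2]⟩]
  ring_nf

theorem IsGeodesicOn.continuousOn {γ : ℝ → X} {J : Set ℝ} (h : IsGeodesicOn γ J) :
    ContinuousOn γ J := by
  rw [Metric.continuousOn_iff]
  intro b hb ε hε
  exact ⟨ε, hε, fun a ha hab => by rw [h a ha b hb, ← Real.dist_eq]; exact hab⟩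

/-- Nearest points on geodesics exist. -/
theorem IsGeodesicOn.exists_nearest {γ : ℝ → X} {J : Set ℝ} (h : IsGeodesicOn γ J)
    (hJ : IsClosed J) (hne : J.Nonempty) (x : X) :
    ∃ s ∈ J, ∀ t ∈ J, dist x (γ s) ≤ dist x (γ t) := by
  obtain ⟨s₀, hs₀⟩ := hne
  -- If |t - s₀| > R, the triangle inequality makes γ t farther from x than γ s₀, so the minimum may
  -- be sought on a compact window.
  set R := 2 * dist x (γ s₀) with hR
  have hR0 : 0 ≤ R := by positivity
  have hK : IsCompact (J ∩ Set.Icc (s₀ - R) (s₀ + R)) := isCompact_Icc.inter_left hJ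
  obtain ⟨s, hs, hmin⟩ := hK.exists_isMinOn (f := fun t => dist x (γ t))
    ⟨s₀, hs₀, by linarith, by linarith⟩
    ((continuous_const.dist continuous_id).comp_continuousOn
      (h.continuousOn.mono Set.inter_subset_left))
  refine ⟨s, hs.1, fun t ht => ?_⟩
  by_cases htR : t ∈ Set.Icc (s₀ - R) (s₀ + R)
  · exact hmin ⟨ht, htR⟩
  · have h1 : dist x (γ s) ≤ dist x (γ s₀) := hmin ⟨hs₀, by linarith, by linarith⟩
    have h2 : R < |t - s₀| := by
      by_contra hcon
      push Not at hcon
      rw [abs_le] at hcon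
      exact htR ⟨by linarith, by linarith⟩
    have h3 := h t ht s₀ hs₀
    have h4 := dist_triangle (γ t) x (γ s₀)
    rw [dist_comm (γ t) x] at h4
    linarith

theorem IsQIEmbeddingOn.perturb {A : Type*} [MetricSpace A] {l e D : ℝ} {σ τ : A → X} {S : Set A}
    (h : IsQIEmbeddingOn l e σ S) (hD : ∀ s ∈ S, dist (σ s) (τ s) ≤ D) :
    IsQIEmbeddingOn l (e + 2 * D) τ S := by
  intro s hs t ht
  obtain ⟨h1, h2⟩ := h s hs t ht
  have d1 := hD s hs
  have d2 := hD t ht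
  have t1 := dist_triangle4 (σ s) (τ s) (τ t) (σ t)
  have t2 := dist_triangle4 (τ s) (σ s) (σ t) (τ t)
  rw [dist_comm (τ t) (σ t)] at t1
  rw [dist_comm (τ s) (σ s)] at t2
  constructor <;> linarith

theorem IsQIEmbeddingOn.mono_const {A : Type*} [MetricSpace A] {l l' e e' : ℝ} {σ : A → X}
    {S : Set A} (h : IsQIEmbeddingOn l e σ S) (hl : 0 < l) (hll : l ≤ l') (he : e ≤ e') :
    IsQIEmbeddingOn l' e' σ S := by
  intro s hs t ht
  obtain ⟨h1, h2⟩ := h s hs t ht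
  have h3 : 1 / l' * dist s t ≤ 1 / l * dist s t :=
    mul_le_mul_of_nonneg_right (one_div_le_one_div_of_le hl hll) dist_nonneg
  have h4 : l * dist s t ≤ l' * dist s t := mul_le_mul_of_nonneg_right hll dist_nonneg
  constructor <;> linarith

theorem IsQIEmbeddingOn.dist_le {A : Type*} [MetricSpace A] {l e : ℝ} {σ : A → X} {S : Set A}
    (h : IsQIEmbeddingOn l e σ S) (hl : 0 < l) {s t : A} (hs : s ∈ S) (ht : t ∈ S) :
    dist s t ≤ l * (dist (σ s) (σ t) + e) := by
  have h1 := (h s hs t ht).1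
  rw [one_div] at h1
  have h2 : l⁻¹ * dist s t ≤ dist (σ s) (σ t) + e := by linarith
  rwa [inv_mul_le_iff₀ hl] at h2

/-- Quasi-geodesics with endpoints near a Morse set stay uniformly close to it. -/
theorem exists_morse_bound (N : MorseGauge) {l : ℝ} (hl : 1 ≤ l) (e D : ℝ) :
    ∃ C : ℝ, 0 ≤ C ∧ ∀ {A : Set X}, IsMorse N A → ∀ {σ : ℝ → X} {a b : ℝ},
      IsQIEmbeddingOn l e σ (Set.Icc a b) → (∃ y ∈ A, dist (σ a) y ≤ D) →
      (∃ y ∈ A, dist (σ b) y ≤ D) → ∀ t ∈ Set.Icc a b, ∃ y ∈ A, dist (σ t) y ≤ C := by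
  set D' := max D 0
  have hD0 : 0 ≤ D' := le_max_right _ _
  have hDD : D ≤ D' := le_max_left _ _
  set e' : ℝ≥0 := (e + 2 * D').toNNReal
  have he' : e + 2 * D' ≤ (e' : ℝ) := Real.le_coe_toNNReal _
  refine ⟨N ⟨l, hl⟩ e' + D', by positivity, ?_⟩
  rintro A hA σ a b hσ ⟨x, hx, hxa⟩ ⟨y, hy, hyb⟩ t ht
  have hab : a ≤ b := ht.1.trans ht.2
  have hN : (0 : ℝ) ≤ N ⟨l, hl⟩ e' := NNReal.coe_nonneg _
  by_cases hta : t = a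
  · exact ⟨x, hx, by rw [hta]; linarith⟩
  by_cases htb : t = b
  · exact ⟨y, hy, by rw [htb]; linarith⟩
  have hne : b ≠ a := by
    rintro rfl
    exact hta (le_antisymm ht.2 ht.1)
  -- Only the two endpoints are moved onto `A`; this costs 2D in the additive constant.
  set τ : ℝ → X := fun s => if s = a then x else if s = b then y else σ s
  have hτ : IsQIEmbeddingOn l e' τ (Set.Icc a b) := by
    refine (hσ.perturb (D := D') fun s _ => ?_).mono_const (by linarith) le_rfl he'
    by_cases h1 : s = a
    · simp only [τ, h1, if_true]; exact hxa.trans hDD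
    · by_cases h2 : s = b
      · simp only [τ, h2, hne, if_true, if_false]; exact hyb.trans hDD
      · simp only [τ, h1, h2, if_false, dist_self]; exact hD0
  obtain ⟨z, hz, hzt⟩ := hA ⟨l, hl⟩ e' a b τ hab hτ (by simpa [τ] using hx)
    (by simpa [τ, hne] using hy) t ht
  refine ⟨z, hz, ?_⟩
  simp only [τ, hta, htb, if_false] at hzt
  linarith

/-- A uniform bound for all quasi-geodesics gives a Morse gauge. -/
theorem exists_gauge {P : Set X → Prop}
    (H : ∀ l : ℝ, 1 ≤ l → ∀ e : ℝ, 0 ≤ e → ∃ C : ℝ, ∀ A, P A → ∀ (a b : ℝ) (σ : ℝ → X), a ≤ b →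
      IsQIEmbeddingOn l e σ (Set.Icc a b) → σ a ∈ A → σ b ∈ A →
      ∀ t ∈ Set.Icc a b, ∃ y ∈ A, dist (σ t) y ≤ C) :
    ∃ N : MorseGauge, ∀ A, P A → IsMorse N A := by
  choose C hC using H
  refine ⟨fun l e => (C l.1 l.2 e e.2).toNNReal, fun A hA l e a b σ hab hσ ha hb t ht => ?_⟩
  obtain ⟨y, hy, hyt⟩ := hC l.1 l.2 e e.2 A hA a b σ hab hσ ha hb t ht
  exact ⟨y, hy, hyt.trans (Real.le_coe_toNNReal _)⟩

/-- The coarse intermediate value theorem. -/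
theorem exists_abs_sub_le_of_le {r : ℝ → ℝ} {a b x J : ℝ} (hab : a ≤ b)
    (hr : ∀ s ∈ Set.Icc a b, ∀ t ∈ Set.Icc a b, |s - t| ≤ 1 → |r s - r t| ≤ J)
    (ha : r a ≤ x) (hb : x ≤ r b) : ∃ t ∈ Set.Icc a b, |r t - x| ≤ J := by
  set S := {t ∈ Set.Icc a b | r t ≤ x} with hS
  have haS : a ∈ S := ⟨⟨le_rfl, hab⟩, ha⟩
  have hbdd : BddAbove S := ⟨b, fun t ht => ht.1.2⟩
  obtain ⟨t, ht, hlt⟩ := exists_lt_of_lt_csSup ⟨a, haS⟩ (show sSup S - 1 < sSup S by linarith)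
  refine ⟨t, ht.1, ?_⟩
  -- Since t lies within 1 of the supremum, a step of length 1 (or to b) leaves `S`, so r crosses x
  -- during one jump.
  have hx : x ≤ r (min (t + 1) b) := by
    rcases le_total (t + 1) b with h | h
    · rw [min_eq_left h]
      by_contra hcon
      push Not at hcon
      have := le_csSup hbdd (show t + 1 ∈ S from ⟨⟨by linarith [ht.1.1], h⟩, hcon.le⟩)
      linarith
    · rwa [min_eq_right h]
  have h1 : t ≤ min (t + 1) b := le_min (by linarith) ht.1.2
  have h2 := hr t ht.1 (min (t + 1) b) ⟨ht.1.1.trans h1, min_le_right _ _⟩ (by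
    rw [abs_sub_comm, abs_of_nonneg (by linarith)]
    linarith [min_le_left (t + 1) b])
  have h3 := ht.2
  rw [abs_le] at h2 ⊢
  constructor <;> linarith

theorem exists_abs_sub_le_of_mem_uIcc {r : ℝ → ℝ} {a b x J : ℝ} (hab : a ≤ b)
    (hr : ∀ s ∈ Set.Icc a b, ∀ t ∈ Set.Icc a b, |s - t| ≤ 1 → |r s - r t| ≤ J)
    (hx : x ∈ Set.uIcc (r a) (r b)) : ∃ t ∈ Set.Icc a b, |r t - x| ≤ J := by
  rcases Set.mem_uIcc.1 hx with h | h
  · exact exists_abs_sub_le_of_le hab hr h.1 h.2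
  · obtain ⟨t, ht, hJ⟩ := exists_abs_sub_le_of_le (r := fun t => - r t) (x := -x) hab
      (fun s hs t ht hst => by
        have := hr s hs t ht hst
        rwa [neg_sub_neg, abs_sub_comm]) (neg_le_neg h.2) (neg_le_neg h.1)
    exact ⟨t, ht, by rwa [neg_sub_neg, abs_sub_comm] at hJ⟩

/-- If a path stays close to a quasi-geodesic `τ`, then `τ` stays close to the path between the
parameters of the two endpoints. -/
theorem exists_dist_le_of_mem_uIcc {β τ : ℝ → X} {S : Set ℝ} {l e C a b x : ℝ} {r : ℝ → ℝ}
    (hl : 1 ≤ l) (hβ : IsGeodesicOn β (Set.Icc a b)) (hτ : IsQIEmbeddingOn l e τ S) (hab : a ≤ b)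
    (hrS : ∀ t ∈ Set.Icc a b, r t ∈ S) (hr : ∀ t ∈ Set.Icc a b, dist (β t) (τ (r t)) ≤ C)
    (hxS : x ∈ S) (hx : x ∈ Set.uIcc (r a) (r b)) :
    ∃ t ∈ Set.Icc a b, dist (τ x) (β t) ≤ l * (l * (1 + 2 * C + e)) + e + C := by
  -- The function r may be discontinuous, but over a unit step it jumps by at most l(1 + 2C + e), as
  -- `τ` is a quasi-isometric embedding.
  obtain ⟨t, ht, hJ⟩ := exists_abs_sub_le_of_mem_uIcc (J := l * (1 + 2 * C + e)) hab
    (fun s hs t ht hst => by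
      rw [← Real.dist_eq]
      refine (hτ.dist_le (by linarith) (hrS s hs) (hrS t ht)).trans ?_
      have h1 := dist_triangle4 (τ (r s)) (β s) (β t) (τ (r t))
      have h2 := hr s hs
      have h3 := hr t ht
      rw [dist_comm] at h2
      rw [hβ s hs t ht] at h1
      exact mul_le_mul_of_nonneg_left (by linarith) (by linarith)) hx
  refine ⟨t, ht, ?_⟩
  have h1 := (hτ x hxS (r t) (hrS t ht)).2
  rw [Real.dist_eq, abs_sub_comm] at h1
  have h2 : l * |r t - x| ≤ l * (l * (1 + 2 * C + e)) := mul_le_mul_of_nonneg_left hJ (by linarith)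
  have h3 := dist_triangle (τ x) (τ (r t)) (β t)
  have h4 := hr t ht
  rw [dist_comm] at h4
  linarith

end Basic

/-! ### Geodesics whose ends approach a Morse set -/

section Projection

variable {X : Type*} [MetricSpace X]

theorem abs_sub_le_of_nearest {γ : ℝ → X} {J : Set ℝ} (h : IsGeodesicOn γ J) {x : X} {s t D : ℝ}
    (hs : s ∈ J) (hn : ∀ t ∈ J, dist x (γ s) ≤ dist x (γ t)) (ht : t ∈ J)
    (hD : dist x (γ t) ≤ D) : |s - t| ≤ 2 * D ∧ dist x (γ s) ≤ D := by
  have h1 := hn t ht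
  have h2 := dist_triangle (γ s) x (γ t)
  rw [h s hs t ht, dist_comm (γ s) x] at h2
  constructor <;> linarith

/-- A geodesic both of whose ends come close to a Morse set is uniformly close to the Morse set,
away from its ends. -/
theorem exists_bound_of_two_ends (hX : IsGeodesicSpace X) (N : MorseGauge) :
    ∃ C : ℝ, 0 ≤ C ∧ ∀ {A : Set X}, IsMorse N A → ∀ {γ : ℝ → X} {J : Set ℝ}, IsGeodesicOn γ J →
      IsClosed J → J.OrdConnected → ∀ {t₁ t₂ D : ℝ} {u v : X}, t₁ ∈ J → t₂ ∈ J → u ∈ A → v ∈ A →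
      dist u (γ t₁) ≤ D → dist v (γ t₂) ≤ D → t₁ + 8 * D ≤ t₂ →
      ∀ t ∈ Set.Icc (t₁ + 2 * D) (t₂ - 2 * D), ∃ y ∈ A, dist (γ t) y ≤ C := by
  obtain ⟨C, hC0, hC⟩ := exists_morse_bound (X := X) N (l := 3) (by norm_num) 0 0
  refine ⟨C, hC0, ?_⟩
  intro A hA γ J hγ hJc hJo t₁ t₂ D u v ht₁ ht₂ hu hv hut hvt h12 t ht
  obtain ⟨b, hb, hbn⟩ := hγ.exists_nearest hJc ⟨t₁, ht₁⟩ u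
  obtain ⟨c, hc, hcn⟩ := hγ.exists_nearest hJc ⟨t₁, ht₁⟩ v
  obtain ⟨hb1, hb2⟩ := abs_sub_le_of_nearest hγ hb hbn ht₁ hut
  obtain ⟨hc1, hc2⟩ := abs_sub_le_of_nearest hγ hc hcn ht₂ hvt
  rw [abs_le] at hb1 hc1
  have hD0 : 0 ≤ D := dist_nonneg.trans hut
  obtain ⟨c₁, hc₁a, hc₁b, hc₁⟩ := hX.exists_segment u (γ b) (b - dist u (γ b))
  obtain ⟨c₃, hc₃a, hc₃b, hc₃⟩ := hX.exists_segment (γ c) v c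
  rw [sub_add_cancel] at hc₁b hc₁
  rw [dist_comm (γ c) v] at hc₃ hc₃b
  set a := b - dist u (γ b) with ha
  set d := c + dist v (γ c) with hd
  have hab : a ≤ b := by rw [ha]; linarith [dist_nonneg (x := u) (y := γ b)]
  have hcd : c ≤ d := by rw [hd]; linarith [dist_nonneg (x := v) (y := γ c)]
  -- Projecting moves each parameter by at most 2D, so a gap of 8D leaves 4D. The outer legs have
  -- total length x ≤ 2D and the middle has length L ≥ 4D. Points on the two legs therefore satisfy
  -- x + L ≤ 3(L - x), which is the tameness estimate between them.
  have hbc : b + 4 * D ≤ c := by linarith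
  have hbcJ : Set.Icc b c ⊆ J := hJo.out hb hc
  have tame₁ : IsTameOn 3 (fun t => if t ≤ b then c₁ t else γ t) (Set.Icc a c) := by
    refine (hc₁.isTameOn (by norm_num)).glue ((hγ.mono hbcJ).isTameOn (by norm_num)) hc₁b ?_
    intro s hs t ht
    refine sub_le_three_mul_dist_of_nearest_left hc₁ hγ hb hc₁b ?_ hs (hbcJ ht) ht.1
    rw [hc₁a]; exact hbn
  have tame₂ : IsTameOn 3 (fun t => if t ≤ c then (if t ≤ b then c₁ t else γ t) else c₃ t)
      (Set.Icc a d) := by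
    refine tame₁.glue (hc₃.isTameOn (by norm_num)) ?_ ?_
    · rw [hc₃a]
      split_ifs with h
      · rw [show c = b by linarith, hc₁b]
      · rfl
    intro s hs t ht
    by_cases hsb : s ≤ b
    · simp only [hsb, if_true]
      have e1 := hc₁.dist_of_le ⟨hs.1, hsb⟩ ⟨hab, le_rfl⟩ hsb
      have e2 := hc₃.dist_of_le ⟨le_rfl, hcd⟩ ht ht.1
      have e3 := hγ.dist_of_le hb hc (by linarith)
      rw [hc₁b] at e1
      rw [hc₃a] at e2
      have e4 := dist_triangle4 (γ b) (c₁ s) (c₃ t) (γ c)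
      rw [dist_comm (γ b) (c₁ s), dist_comm (c₃ t) (γ c)] at e4
      have e5 := hs.1
      have e6 := ht.2
      linarith
    · simp only [hsb, if_false]
      push Not at hsb
      refine sub_le_three_mul_dist_of_nearest_right hc₃ hγ hc hc₃a ?_ (hbcJ ⟨hsb.le, hs.2⟩) hs.2 ht
      rw [hc₃b]; exact hcn
  obtain ⟨y, hy, hyt⟩ := hC hA (tame₂.isQIEmbeddingOn (by norm_num))
    ⟨u, hu, by simp [show a ≤ c by linarith, hab, hc₁a]⟩ ⟨v, hv, by
      by_cases h : d ≤ c
      · have hdc : d = c := le_antisymm h hcd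
        have hvc : γ c = v := by rw [← hc₃a, ← hdc, hc₃b]
        simp only [hdc, le_refl, if_true]
        split_ifs with h'
        · rw [show c = b by linarith, hc₁b, show b = c by linarith, hvc, dist_self]
        · rw [hvc, dist_self]
      · simp [h, hc₃b]⟩ t ⟨by linarith [ht.1], by linarith [ht.2]⟩
  refine ⟨y, hy, ?_⟩
  have h1 : t ≤ c := by linarith [ht.2]
  simp only [h1, if_true] at hyt
  split_ifs at hyt with h2
  · have : t = b := le_antisymm h2 (by linarith [ht.1])
    rwa [this, hc₁b, ← this] at hyt
  · exact hyt

/-- If `γ b` is a nearest point to a point `x` near a Morse set, then the part of the geodesic `γ`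
between `γ b` and a point near the Morse set is uniformly close to the Morse set. -/
theorem exists_bound_of_nearest (hX : IsGeodesicSpace X) (N : MorseGauge) (K : ℝ) :
    ∃ C : ℝ, 0 ≤ C ∧ ∀ {A : Set X}, IsMorse N A → ∀ {γ : ℝ → X} {J : Set ℝ}, IsGeodesicOn γ J →
      J.OrdConnected → ∀ {b c : ℝ} {x : X}, b ∈ J → c ∈ J →
      (∀ t ∈ J, dist x (γ b) ≤ dist x (γ t)) → (∃ y ∈ A, dist x y ≤ K) →
      (∃ y ∈ A, dist (γ c) y ≤ K) → ∀ t ∈ Set.uIcc b c, ∃ y ∈ A, dist (γ t) y ≤ C := by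
  obtain ⟨C, hC0, hC⟩ := exists_morse_bound (X := X) N (l := 3) (by norm_num) 0 K
  refine ⟨max C K, hC0.trans (le_max_left _ _), ?_⟩
  intro A hA γ J hγ hJ b c x hb hc hn hx hcA t ht
  by_cases htc : t = c
  · rw [htc]
    obtain ⟨y, hy, hyc⟩ := hcA
    exact ⟨y, hy, hyc.trans (le_max_right _ _)⟩
  suffices h : ∃ y ∈ A, dist (γ t) y ≤ C by
    obtain ⟨y, hy, hyt⟩ := h
    exact ⟨y, hy, hyt.trans (le_max_left _ _)⟩
  have hxb : 0 ≤ dist x (γ b) := dist_nonneg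
  rcases le_total b c with hbc | hcb
  · rw [Set.uIcc_of_le hbc] at ht
    obtain ⟨d, hda, hdb, hd⟩ := hX.exists_segment x (γ b) (b - dist x (γ b))
    rw [sub_add_cancel] at hdb hd
    set a := b - dist x (γ b) with ha
    have hab : a ≤ b := by linarith
    have hbcJ : Set.Icc b c ⊆ J := hJ.out hb hc
    -- The shortest segment from x is followed by the geodesic. Its ends are within K of `A`, so the
    -- Morse bound applies whatever the length of that segment.
    have tame : IsTameOn 3 (fun t => if t ≤ b then d t else γ t) (Set.Icc a c) := by
      refine (hd.isTameOn (by norm_num)).glue ((hγ.mono hbcJ).isTameOn (by norm_num)) hdb ?_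
      intro s hs t ht
      refine sub_le_three_mul_dist_of_nearest_left hd hγ hb hdb ?_ hs (hbcJ ht) ht.1
      rwa [hda]
    have hcb : ¬ c ≤ b := fun h => htc (le_antisymm ht.2 (h.trans ht.1))
    obtain ⟨y, hy, hyt⟩ := hC hA (tame.isQIEmbeddingOn (by norm_num)) (by simpa [hab, hda])
      (by simpa [hcb]) t ⟨by linarith [ht.1], ht.2⟩
    refine ⟨y, hy, ?_⟩
    by_cases htb : t ≤ b
    · have : t = b := le_antisymm htb ht.1
      simpa [this, hdb] using hyt
    · simpa [htb] using hyt
  · rw [Set.uIcc_of_ge hcb] at ht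
    obtain ⟨d, hda, hdb, hd⟩ := hX.exists_segment (γ b) x b
    rw [dist_comm (γ b) x] at hd hdb
    set a := b + dist x (γ b) with ha
    have hab : b ≤ a := by linarith
    have hbcJ : Set.Icc c b ⊆ J := hJ.out hc hb
    have tame : IsTameOn 3 (fun t => if t ≤ b then γ t else d t) (Set.Icc c a) := by
      refine ((hγ.mono hbcJ).isTameOn (by norm_num)).glue (hd.isTameOn (by norm_num)) hda.symm ?_
      intro s hs t ht
      refine sub_le_three_mul_dist_of_nearest_right hd hγ hb hda ?_ (hbcJ hs) hs.2 ht
      rwa [hdb]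
    obtain ⟨y, hy, hyt⟩ := hC hA (tame.isQIEmbeddingOn (by norm_num)) (by simpa [hcb])
      (by
        by_cases h : a ≤ b
        · have hba : a = b := le_antisymm h hab
          rw [hba] at hdb
          simpa [hba, ← hda, hdb]
        · simpa [h, hdb])
      t ⟨ht.1, by linarith [ht.2]⟩
    exact ⟨y, hy, by simpa [ht.2] using hyt⟩

/-- A geodesic that starts near a Morse set and comes back close to the Morse set is uniformly
close to the Morse set in between. -/
theorem exists_bound_of_one_end (hX : IsGeodesicSpace X) (N : MorseGauge) (K : ℝ) :
    ∃ C : ℝ, 0 ≤ C ∧ ∀ {A : Set X}, IsMorse N A → ∀ {γ : ℝ → X} {J : Set ℝ}, IsGeodesicOn γ J →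
      IsClosed J → J.OrdConnected → ∀ {t₁ t₂ D : ℝ} {v : X}, t₁ ∈ J → t₂ ∈ J →
      (∃ y ∈ A, dist (γ t₁) y ≤ K) → v ∈ A → dist v (γ t₂) ≤ D →
      ∀ t ∈ Set.Icc t₁ (t₂ - 2 * D), ∃ y ∈ A, dist (γ t) y ≤ C := by
  obtain ⟨C, hC0, hC⟩ := exists_bound_of_nearest hX N (max K 0)
  refine ⟨C, hC0, ?_⟩
  intro A hA γ J hγ hJc hJo t₁ t₂ D v ht₁ ht₂ hK hv hvt t ht
  -- The projection of v has parameter at least t₂ - 2D, so the stretch from t₁ to it contains every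
  -- t in question.
  obtain ⟨c, hc, hcn⟩ := hγ.exists_nearest hJc ⟨t₁, ht₁⟩ v
  obtain ⟨hc1, -⟩ := abs_sub_le_of_nearest hγ hc hcn ht₂ hvt
  rw [abs_le] at hc1
  obtain ⟨y, hy, hyK⟩ := hK
  exact hC hA hγ hJo hc ht₁ hcn ⟨v, hv, by simp⟩ ⟨y, hy, hyK.trans (le_max_left _ _)⟩ t
    (Set.mem_uIcc_of_ge ht.1 (by linarith [ht.2]))

end Projection

/-! ### Coarse closeness and invariance of the Morse property -/

/-- Each of the sets `A`, `B` is contained in the `C`-neighbourhood of the other one. -/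
def CoarselyClose {X : Type*} [MetricSpace X] (C : ℝ) (A B : Set X) : Prop :=
  (∀ x ∈ A, ∃ y ∈ B, dist x y ≤ C) ∧ ∀ y ∈ B, ∃ x ∈ A, dist y x ≤ C

section Coarse

variable {X Y : Type*} [MetricSpace X] [MetricSpace Y]

theorem CoarselyClose.symm {C : ℝ} {A B : Set X} (h : CoarselyClose C A B) :
    CoarselyClose C B A := ⟨h.2, h.1⟩

theorem CoarselyClose.trans {C C' : ℝ} {A B D : Set X} (h : CoarselyClose C A B)
    (h' : CoarselyClose C' B D) : CoarselyClose (C + C') A D := by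
  constructor
  · intro x hx
    obtain ⟨y, hy, h1⟩ := h.1 x hx
    obtain ⟨z, hz, h2⟩ := h'.1 y hy
    exact ⟨z, hz, by linarith [dist_triangle x y z]⟩
  · intro x hx
    obtain ⟨y, hy, h1⟩ := h'.2 x hx
    obtain ⟨z, hz, h2⟩ := h.2 y hy
    exact ⟨z, hz, by linarith [dist_triangle x y z]⟩

theorem CoarselyClose.image {f : X → Y} {l e : ℝ} (hl : 0 ≤ l)
    (hf : ∀ x x', dist (f x) (f x') ≤ l * dist x x' + e)
    {C : ℝ} {A B : Set X} (h : CoarselyClose C A B) :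
    CoarselyClose (l * C + e) (f '' A) (f '' B) := by
  constructor
  · rintro _ ⟨x, hx, rfl⟩
    obtain ⟨y, hy, h1⟩ := h.1 x hx
    exact ⟨f y, ⟨y, hy, rfl⟩, (hf x y).trans (by gcongr)⟩
  · rintro _ ⟨x, hx, rfl⟩
    obtain ⟨y, hy, h1⟩ := h.2 x hx
    exact ⟨f y, ⟨y, hy, rfl⟩, (hf x y).trans (by gcongr)⟩

/-- The bound is the Hausdorff distance plus 1, because nearest points need not exist in general
sets. -/
theorem asymptotic_iff {A B : Set X} : Asymptotic A B ↔ ∃ C, CoarselyClose C A B := by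
  constructor
  · intro h
    set r := Metric.hausdorffEDist A B with hr
    have key : ∀ {x y : X}, edist x y < r + 1 → dist x y ≤ (r + 1).toReal := by
      intro x y hxy
      rw [dist_edist]
      exact ENNReal.toReal_mono (ENNReal.add_ne_top.2 ⟨h, ENNReal.one_ne_top⟩) hxy.le
    have hlt : r < r + 1 := ENNReal.lt_add_right h one_ne_zero
    refine ⟨(r + 1).toReal, fun x hx => ?_, fun x hx => ?_⟩
    · obtain ⟨y, hy, hxy⟩ := Metric.exists_edist_lt_of_hausdorffEDist_lt hx hlt
      exact ⟨y, hy, key hxy⟩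
    · obtain ⟨y, hy, hxy⟩ := Metric.exists_edist_lt_of_hausdorffEDist_lt hx
        (by rwa [Metric.hausdorffEDist_comm])
      exact ⟨y, hy, key hxy⟩
  · rintro ⟨C, h1, h2⟩
    refine ne_top_of_le_ne_top (ENNReal.ofReal_ne_top (r := C))
      (Metric.hausdorffEDist_le_of_mem_edist (fun x hx => ?_) fun x hx => ?_)
    · obtain ⟨y, hy, h⟩ := h1 x hx
      exact ⟨y, hy, by rw [edist_dist]; exact ENNReal.ofReal_le_ofReal h⟩
    · obtain ⟨y, hy, h⟩ := h2 x hx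
      exact ⟨y, hy, by rw [edist_dist]; exact ENNReal.ofReal_le_ofReal h⟩

theorem CoarselyClose.asymptotic {C : ℝ} {A B : Set X} (h : CoarselyClose C A B) :
    Asymptotic A B := asymptotic_iff.2 ⟨C, h⟩

theorem Asymptotic.symm {A B : Set X} (h : Asymptotic A B) : Asymptotic B A := by
  obtain ⟨C, hC⟩ := asymptotic_iff.1 h
  exact hC.symm.asymptotic

theorem Asymptotic.trans {A B D : Set X} (h : Asymptotic A B) (h' : Asymptotic B D) :
    Asymptotic A D := by
  obtain ⟨C, hC⟩ := asymptotic_iff.1 h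
  obtain ⟨C', hC'⟩ := asymptotic_iff.1 h'
  exact (hC.trans hC').asymptotic

theorem IsQIEmbeddingOn.comp {A : Type*} [MetricSpace A] {f : X → Y} {m d l e : ℝ}
    (hm : 1 ≤ m) (he : 0 ≤ e) (hf : IsQIEmbeddingOn m d f Set.univ) {σ : A → X}
    {S : Set A} (hσ : IsQIEmbeddingOn l e σ S) :
    IsQIEmbeddingOn (m * l) (m * e + d) (fun s => f (σ s)) S := by
  intro s hs t ht
  obtain ⟨h1, h2⟩ := hf (σ s) trivial (σ t) trivial
  obtain ⟨h3, h4⟩ := hσ s hs t ht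
  have hm0 : (0 : ℝ) < m := by linarith
  constructor
  · have h5 : 1 / m * (1 / l * dist s t - e) ≤ 1 / m * dist (σ s) (σ t) :=
      mul_le_mul_of_nonneg_left h3 (by positivity)
    have h6 : 1 / m * e ≤ m * e := by
      refine mul_le_mul_of_nonneg_right ?_ he
      rw [div_le_iff₀ hm0]; nlinarith
    have h7 : 1 / (m * l) * dist s t = 1 / m * (1 / l * dist s t) := by
      rw [one_div_mul_eq_div, one_div_mul_eq_div, one_div_mul_eq_div, div_div, mul_comm m l]
    rw [h7]
    linarith
  · have h5 : m * dist (σ s) (σ t) ≤ m * (l * dist s t + e) :=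
      mul_le_mul_of_nonneg_left h4 hm0.le
    nlinarith

theorem IsQuasiIsometry.refl : IsQuasiIsometry (fun x : X => x) :=
  ⟨⟨1, 0, le_rfl, le_rfl, fun s _ t _ => by constructor <;> simp⟩, fun x => x, 0, le_rfl,
    fun x => by simp, fun x => by simp⟩

theorem IsQuasiIsometry.exists_inverse {f : X → Y} (hf : IsQuasiIsometry f) :
    ∃ g : Y → X, IsQuasiIsometry g ∧ ∃ D : ℝ, 0 ≤ D ∧ (∀ x, dist (g (f x)) x ≤ D) ∧
      ∀ y, dist (f (g y)) y ≤ D := by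
  obtain ⟨⟨l, e, hl, he, hle⟩, g, D, hD, hgf, hfg⟩ := hf
  refine ⟨g, ⟨⟨l, l * (2 * D + e), hl, by positivity, ?_⟩, f, D, hD, hfg, hgf⟩, D, hD, hgf, hfg⟩
  intro s _ t _
  have h1 := hle.dist_le (by linarith) (Set.mem_univ (g s)) (Set.mem_univ (g t))
  have h2 := (hle (g s) trivial (g t) trivial).2
  have h3 := dist_triangle4 (f (g s)) s t (f (g t))
  have h4 := dist_triangle4 s (f (g s)) (f (g t)) t
  have h5 := hfg s
  have h6 := hfg t
  rw [dist_comm s (f (g s))] at h4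
  rw [dist_comm t (f (g t))] at h3
  constructor
  · have h7 : 1 / l * (dist s t) ≤ 1 / l * (l * dist (g s) (g t) + (2 * D + e)) :=
      mul_le_mul_of_nonneg_left (by linarith) (by positivity)
    have h8 : 1 / l * (l * dist (g s) (g t) + (2 * D + e)) =
        dist (g s) (g t) + 1 / l * (2 * D + e) := by field_simp
    have h9 : 1 / l * (2 * D + e) ≤ l * (2 * D + e) := by
      refine mul_le_mul_of_nonneg_right ?_ (by positivity)
      rw [div_le_iff₀ (by linarith)]; nlinarith
    linarith
  · have h7 : l * (dist (f (g s)) (f (g t)) + e) ≤ l * (dist s t + 2 * D + e) :=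
      mul_le_mul_of_nonneg_left (by linarith) (by linarith)
    linarith

theorem Asymptotic.image {f : X → Y} (hf : IsQuasiIsometry f) {A B : Set X}
    (h : Asymptotic A B) : Asymptotic (f '' A) (f '' B) := by
  obtain ⟨⟨l, e, hl, he, hle⟩, -⟩ := hf
  obtain ⟨C, hC⟩ := asymptotic_iff.1 h
  exact (hC.image (by linarith) fun x x' => (hle x trivial x' trivial).2).asymptotic

/-- Quasi-isometries preserve Morse sets. -/
theorem IsQuasiIsometry.exists_gauge_image {f : X → Y} (hf : IsQuasiIsometry f) (N : MorseGauge) :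
    ∃ N' : MorseGauge, ∀ A : Set X, IsMorse N A → IsMorse N' (f '' A) := by
  obtain ⟨g, ⟨⟨m, d, hm, hd, hmd⟩, -⟩, D, hD, hgf, hfg⟩ := hf.exists_inverse
  obtain ⟨⟨l₀, e₀, hl₀, he₀, hle₀⟩, -⟩ := hf
  suffices h : ∃ N' : MorseGauge, ∀ B : Set Y, (∃ A, IsMorse N A ∧ f '' A = B) → IsMorse N' B by
    obtain ⟨N', hN'⟩ := h
    exact ⟨N', fun A hA => hN' _ ⟨A, hA, rfl⟩⟩
  refine exists_gauge fun l hl e he => ?_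
  obtain ⟨C, hC0, hC⟩ := exists_morse_bound (X := X) N (l := m * l) (by nlinarith) (m * e + d) D
  refine ⟨l₀ * C + e₀ + D, ?_⟩
  rintro _ ⟨A, hA, rfl⟩ a b σ hab hσ ⟨x, hx, hxa⟩ ⟨y, hy, hyb⟩ t ht
  -- The quasi-geodesic is pulled back by g. Its new ends are within D of `A`, because they are g(f
  -- x) and g(f y) with x, y in `A`.
  obtain ⟨z, hz, hzt⟩ := hC hA (hmd.comp hm he hσ) ⟨x, hx, by rw [← hxa]; exact hgf x⟩
    ⟨y, hy, by rw [← hyb]; exact hgf y⟩ t ht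
  refine ⟨f z, ⟨z, hz, rfl⟩, ?_⟩
  have h1 := (hle₀ (g (σ t)) trivial z trivial).2
  have h2 : l₀ * dist (g (σ t)) z ≤ l₀ * C := mul_le_mul_of_nonneg_left hzt (by linarith)
  have h3 := hfg (σ t)
  rw [dist_comm] at h3
  linarith [dist_triangle (σ t) (f (g (σ t))) (f z)]

theorem exists_gauge_of_coarselyClose (N : MorseGauge) (K : ℝ) :
    ∃ N' : MorseGauge, ∀ A B : Set X, IsMorse N A → CoarselyClose K A B → IsMorse N' B := by
  suffices h : ∃ N' : MorseGauge, ∀ B : Set X, (∃ A, IsMorse N A ∧ CoarselyClose K A B) →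
      IsMorse N' B by
    obtain ⟨N', hN'⟩ := h
    exact ⟨N', fun A B hA hB => hN' _ ⟨A, hA, hB⟩⟩
  refine exists_gauge fun l hl e he => ?_
  obtain ⟨C, hC0, hC⟩ := exists_morse_bound (X := X) N hl e K
  refine ⟨C + K, ?_⟩
  rintro B ⟨A, hA, hAB⟩ a b σ hab hσ ha hb t ht
  obtain ⟨z, hz, hzt⟩ := hC hA hσ (hAB.2 _ ha) (hAB.2 _ hb) t ht
  obtain ⟨y, hy, hyz⟩ := hAB.1 z hz
  exact ⟨y, hy, by linarith [dist_triangle (σ t) z y]⟩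

theorem exists_mem_uIcc_or {s t u : ℝ} (h : u ∉ Set.uIcc s t) :
    t ∈ Set.uIcc s u ∨ s ∈ Set.uIcc u t := by
  simp only [Set.mem_uIcc, not_or, not_and_or, not_le] at *
  rcases le_total s t with h1 | h1 <;> rcases le_total u t with h2 | h2 <;>
    rcases le_total s u with h3 | h3 <;> grind

/-- Subgeodesics of a Morse geodesic line are uniformly Morse. -/
theorem exists_gauge_isMorseLine (N : MorseGauge) :
    ∃ N' : MorseGauge, ∀ γ : ℝ → X, Isometry γ → IsMorse N (Set.range γ) → IsMorseLine N' γ := by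
  suffices h : ∃ N' : MorseGauge, ∀ B : Set X, (∃ (γ : ℝ → X) (J : Set ℝ), Isometry γ ∧
      IsMorse N (Set.range γ) ∧ J.OrdConnected ∧ γ '' J = B) → IsMorse N' B by
    obtain ⟨N', hN'⟩ := h
    exact ⟨N', fun γ hγ hN J _ hJ => hN' _ ⟨γ, J, hγ, hN, hJ, rfl⟩⟩
  refine exists_gauge fun l hl e he => ?_
  obtain ⟨C, hC0, hC⟩ := exists_morse_bound (X := X) N hl e 0
  set J₀ := l + e + 2 * C with hJ₀
  refine ⟨l * (l * (J₀ + C + e)) + e + C, ?_⟩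
  have hl0 : (0 : ℝ) < l := by linarith
  have hb0 : 0 ≤ l * (l * (J₀ + C + e)) + e := by positivity
  rintro _ ⟨γ, J, hγ, hN, hJ, rfl⟩ a b σ hab hσ ⟨s, hs, hsa⟩ ⟨t, ht, htb⟩ r hr
  have haI : a ∈ Set.Icc a b := ⟨le_rfl, hab⟩
  have hbI : b ∈ Set.Icc a b := ⟨hab, le_rfl⟩
  have hclose : ∀ r ∈ Set.Icc a b, ∃ u, dist (σ r) (γ u) ≤ C := by
    intro r hr
    obtain ⟨_, ⟨u, rfl⟩, hu⟩ := hC hN hσ ⟨_, ⟨s, rfl⟩, by rw [hsa, dist_self]⟩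
      ⟨_, ⟨t, rfl⟩, by rw [htb, dist_self]⟩ r hr
    exact ⟨u, hu⟩
  -- The parameter on `γ` is chosen exactly, not just coarsely, at the two ends, so that injectivity
  -- of `γ` gives u a = s and u b = t.
  have hclose' : ∀ r, ∃ u, (r ∈ Set.Icc a b → dist (σ r) (γ u) ≤ C) ∧
      (r = a → γ u = σ a) ∧ (r = b → γ u = σ b) := by
    intro r
    by_cases hra : r = a
    · refine ⟨s, fun _ => by rw [hra, hsa, dist_self]; exact hC0, fun _ => hsa, ?_⟩
      rintro rfl
      rw [hsa, hra]
    by_cases hrb : r = b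
    · exact ⟨t, fun _ => by rw [hrb, htb, dist_self]; exact hC0, fun h => (hra h).elim,
        fun _ => htb⟩
    by_cases hr : r ∈ Set.Icc a b
    · obtain ⟨u, hu⟩ := hclose r hr
      exact ⟨u, fun _ => hu, fun h => (hra h).elim, fun h => (hrb h).elim⟩
    · exact ⟨0, fun h => (hr h).elim, fun h => (hra h).elim, fun h => (hrb h).elim⟩
  choose u hu hua hub using hclose'
  have hus : u a = s := hγ.injective ((hua a rfl).trans hsa.symm)
  have hut : u b = t := hγ.injective ((hub b rfl).trans htb.symm)
  have hstep : ∀ p ∈ Set.Icc a b, ∀ q ∈ Set.Icc a b, |p - q| ≤ 1 → |u p - u q| ≤ J₀ := by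
    intro p hp q hq hpq
    rw [← Real.dist_eq, ← hγ.dist_eq]
    have h1 := dist_triangle4 (γ (u p)) (σ p) (σ q) (γ (u q))
    have h2 := hu p hp
    have h3 := hu q hq
    have h4 := (hσ p hp q hq).2
    rw [Real.dist_eq] at h4
    have h5 : l * |p - q| ≤ l * 1 := mul_le_mul_of_nonneg_left hpq hl0.le
    rw [dist_comm (γ (u p)) (σ p)] at h1
    linarith
  have hfar : ∀ r' ∈ Set.Icc a b, ∀ q ∈ Set.Icc a b, ∀ v, σ q = γ v → |u r' - v| ≤ J₀ →
      |r' - q| ≤ l * (J₀ + C + e) := by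
    intro r' hr' q hq v hv hJ'
    rw [← Real.dist_eq]
    refine (hσ.dist_le hl0 hr' hq).trans (mul_le_mul_of_nonneg_left ?_ hl0.le)
    have h1 := dist_triangle (σ r') (γ (u r')) (γ v)
    have h2 := hu r' hr'
    rw [hγ.dist_eq, Real.dist_eq] at h1
    rw [hv]
    linarith
  have hend : ∀ q ∈ Set.Icc a b, |r - q| ≤ l * (J₀ + C + e) →
      dist (σ r) (σ q) ≤ l * (l * (J₀ + C + e)) + e + C := by
    intro q hq hrq
    have h1 := (hσ r hr q hq).2
    rw [Real.dist_eq] at h1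
    have h2 : l * |r - q| ≤ l * (l * (J₀ + C + e)) := mul_le_mul_of_nonneg_left hrq hl0.le
    linarith
  by_cases hmem : u r ∈ Set.uIcc s t
  · exact ⟨γ (u r), ⟨u r, hJ.uIcc_subset hs ht hmem, rfl⟩, by linarith [hu r hr]⟩
  -- If the shadow u r overshoots t, it passed near t at some earlier time r'. Then σ r' is near σ
  -- b, so r' is near b, and so is r, which lies between them. Overshooting s is symmetric.
  rcases exists_mem_uIcc_or hmem with h | h
  · obtain ⟨r', hr', hJ'⟩ := exists_abs_sub_le_of_mem_uIcc hr.1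
      (fun p hp q hq => hstep p ⟨hp.1, hp.2.trans hr.2⟩ q ⟨hq.1, hq.2.trans hr.2⟩)
      (by rwa [hus] : t ∈ Set.uIcc (u a) (u r))
    have h1 := hfar r' ⟨hr'.1, hr'.2.trans hr.2⟩ b hbI t htb.symm hJ'
    refine ⟨γ t, ⟨t, ht, rfl⟩, ?_⟩
    rw [htb]
    refine hend b hbI (le_trans ?_ h1)
    rw [abs_sub_comm, abs_sub_comm r', abs_of_nonneg (by linarith [hr.2]),
      abs_of_nonneg (by linarith [hr.2, hr'.2])]
    linarith [hr'.2]
  · obtain ⟨r', hr', hJ'⟩ := exists_abs_sub_le_of_mem_uIcc hr.2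
      (fun p hp q hq => hstep p ⟨hr.1.trans hp.1, hp.2⟩ q ⟨hr.1.trans hq.1, hq.2⟩)
      (by rwa [hut] : s ∈ Set.uIcc (u r) (u b))
    have h1 := hfar r' ⟨hr.1.trans hr'.1, hr'.2⟩ a haI s hsa.symm hJ'
    refine ⟨γ s, ⟨s, hs, rfl⟩, ?_⟩
    rw [hsa]
    refine hend a haI (le_trans ?_ h1)
    rw [abs_of_nonneg (by linarith [hr.1]), abs_of_nonneg (by linarith [hr.1, hr'.1])]
    linarith [hr'.1]

end Coarse

/-! ### Arzelà–Ascoli in proper spaces -/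

section Compactness

variable {X : Type*} [MetricSpace X] [ProperSpace X]

/-- Sequences of `1`-Lipschitz paths with bounded starting points subconverge. -/
theorem exists_subseq_tendsto (β : ℕ → ℝ → X) (x₀ : X) (R₀ : ℝ) (hβ : ∀ n, LipschitzWith 1 (β n))
    (h0 : ∀ n, dist (β n 0) x₀ ≤ R₀) :
    ∃ φ : ℕ → ℕ, StrictMono φ ∧ ∃ γ : ℝ → X, LipschitzWith 1 γ ∧
      ∀ R ε : ℝ, 0 < ε → ∀ᶠ n in Filter.atTop, ∀ t ∈ Set.Icc (-R) R,
        dist (β (φ n) t) (γ t) ≤ ε := by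
  set S : Set C(ℝ, X) := {F | LipschitzWith 1 F ∧ dist (F 0) x₀ ≤ R₀} with hS
  have himage : ContinuousMap.toFun '' S = {F : ℝ → X | LipschitzWith 1 F ∧ dist (F 0) x₀ ≤ R₀} := by
    ext F
    constructor
    · rintro ⟨G, hG, rfl⟩
      exact hG
    · intro hF
      exact ⟨⟨F, hF.1.continuous⟩, hF, rfl⟩
  have hcomp : IsCompact S := by
    refine ArzelaAscoli.isCompact_of_equicontinuous S ?_ ?_
    · rw [himage]
      -- In the topology of pointwise convergence the family is closed in a product of closed balls,
      -- which is compact by properness and Tychonoff.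
      refine IsCompact.of_isClosed_subset
        (isCompact_univ_pi fun t : ℝ => isCompact_closedBall x₀ (R₀ + |t|)) ?_ ?_
      · refine IsClosed.inter ?_ ?_
        · have : {F : ℝ → X | LipschitzWith 1 F} =
              ⋂ s : ℝ, ⋂ t : ℝ, {F | dist (F s) (F t) ≤ dist s t} := by
            ext F
            simp [lipschitzWith_iff_dist_le_mul]
          change IsClosed {F : ℝ → X | LipschitzWith 1 F}
          rw [this]
          exact isClosed_iInter fun s => isClosed_iInter fun t =>
            isClosed_le ((continuous_apply s).dist (continuous_apply t)) continuous_const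
        · exact isClosed_le ((continuous_apply (0 : ℝ)).dist continuous_const) continuous_const
      · intro F hF t _
        have h1 := hF.1.dist_le_mul t 0
        rw [NNReal.coe_one, one_mul, Real.dist_eq, sub_zero] at h1
        have h2 := hF.2
        rw [Metric.mem_closedBall]
        linarith [dist_triangle (F t) (F 0) x₀]
    · refine UniformEquicontinuous.equicontinuous ?_
      refine LipschitzWith.uniformEquicontinuous _ 1 fun F => F.2.1
  obtain ⟨G, hG, φ, hφ, hlim⟩ := hcomp.tendsto_subseq
    (x := fun n => (⟨β n, (hβ n).continuous⟩ : C(ℝ, X))) fun n => ⟨hβ n, h0 n⟩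
  refine ⟨φ, hφ, G, hG.1, fun R ε hε => ?_⟩
  rw [ContinuousMap.tendsto_iff_forall_isCompact_tendstoUniformlyOn] at hlim
  have h1 := Metric.tendstoUniformlyOn_iff.1 (hlim _ (isCompact_Icc (a := -R) (b := R))) ε hε
  filter_upwards [h1] with n hn t ht
  have := hn t ht
  rw [dist_comm] at this
  exact this.le

end Compactness

/-! ### Limits of geodesics and quasi-geodesic rays -/

section Limits

variable {X : Type*} [MetricSpace X]

/-- Extension by constants beyond the ends, so that segments of varying length become maps on ℝ to
which Arzelà–Ascoli applies. -/
theorem IsGeodesicOn.exists_lipschitz_extension {c : ℝ → X} {a b : ℝ} (hab : a ≤ b)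
    (hc : IsGeodesicOn c (Set.Icc a b)) :
    ∃ c' : ℝ → X, LipschitzWith 1 c' ∧ ∀ t ∈ Set.Icc a b, c' t = c t := by
  refine ⟨fun t => c (Set.projIcc a b hab t), LipschitzWith.of_dist_le_mul fun s t => ?_,
    fun t ht => by simp [Set.projIcc_of_mem hab ht]⟩
  rw [hc _ (Subtype.coe_prop _) _ (Subtype.coe_prop _)]
  exact (LipschitzWith.projIcc hab).dist_le_mul s t

theorem dist_eq_of_eventually {ι : ℕ → ℕ} {β : ℕ → ℝ → X} {γ : ℝ → X}
    (hlim : ∀ R ε : ℝ, 0 < ε → ∀ᶠ n in Filter.atTop, ∀ t ∈ Set.Icc (-R) R,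
      dist (β (ι n) t) (γ t) ≤ ε) {s t d : ℝ}
    (h : ∀ᶠ n in Filter.atTop, dist (β (ι n) s) (β (ι n) t) = d) : dist (γ s) (γ t) = d := by
  refine eq_of_forall_dist_le fun ε hε => ?_
  obtain ⟨n, h1, h2⟩ := ((hlim (max |s| |t|) (ε / 2) (by linarith)).and h).exists
  have hs := h1 s (abs_le.1 (le_max_left _ _))
  have ht := h1 t (abs_le.1 (le_max_right _ _))
  have t1 := dist_triangle4 (γ s) (β (ι n) s) (β (ι n) t) (γ t)
  have t2 := dist_triangle4 (β (ι n) s) (γ s) (γ t) (β (ι n) t)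
  rw [dist_comm (γ s) (β (ι n) s)] at t1
  rw [dist_comm (γ t) (β (ι n) t)] at t2
  rw [Real.dist_eq, abs_le]
  constructor <;> linarith

/-- If a geodesic ray lies close to a quasi-geodesic ray and they start close to each other, then
they are coarsely close. -/
theorem exists_coarselyClose_of_rays {l e : ℝ} (hl : 1 ≤ l) (he : 0 ≤ e) (C K : ℝ) :
    ∃ C' : ℝ, ∀ {τ β : ℝ → X}, IsQIEmbeddingOn l e τ (Set.Ici 0) → IsGeodesicOn β (Set.Ici 0) →
      dist (β 0) (τ 0) ≤ K → (∀ t ∈ Set.Ici (0 : ℝ), ∃ r ∈ Set.Ici (0 : ℝ), dist (β t) (τ r) ≤ C) →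
      CoarselyClose C' (τ '' Set.Ici 0) (β '' Set.Ici 0) := by
  have hl0 : (0 : ℝ) < l := by linarith
  set C₁ := l * (l * (C + K + e)) + e + K
  set C₂ := l * (l * (1 + 2 * C + e)) + e + C
  refine ⟨max C (max C₁ C₂), fun {τ β} hτ hβ h0 hclose => ⟨?_, ?_⟩⟩
  · rintro _ ⟨x, hx, rfl⟩
    have hclose' : ∀ t, ∃ r ∈ Set.Ici (0 : ℝ), 0 ≤ t → dist (β t) (τ r) ≤ C := by
      intro t
      by_cases ht : 0 ≤ t
      · obtain ⟨r, hr, h⟩ := hclose t ht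
        exact ⟨r, hr, fun _ => h⟩
      · exact ⟨0, Set.self_mem_Ici, fun h => (ht h).elim⟩
    choose r hr0 hr using hclose'
    have hC0 : 0 ≤ C := dist_nonneg.trans (hr 0 le_rfl)
    have hK0 : 0 ≤ K := dist_nonneg.trans h0
    have hx0 : 0 ≤ x := hx
    have hI : (0 : ℝ) ∈ Set.Ici (0 : ℝ) := Set.self_mem_Ici
    by_cases hxr : x ≤ r 0
    · refine ⟨β 0, ⟨0, hI, rfl⟩, le_trans ?_ ((le_max_left _ _).trans (le_max_right _ _))⟩
      have h1 := hτ.dist_le hl0 (hr0 0) hI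
      have h2 := dist_triangle (τ (r 0)) (β 0) (τ 0)
      have h3 := hr 0 le_rfl
      rw [dist_comm] at h3
      have h4 : l * (dist (τ (r 0)) (τ 0) + e) ≤ l * (C + K + e) :=
        mul_le_mul_of_nonneg_left (by linarith) hl0.le
      have h5 := (hτ x hx 0 hI).2
      rw [Real.dist_eq, sub_zero, abs_of_nonneg hx0] at h5
      rw [Real.dist_eq, sub_zero, abs_of_nonneg (hr0 0)] at h1
      have h6 : l * x ≤ l * (l * (C + K + e)) := mul_le_mul_of_nonneg_left (by linarith) hl0.le
      have h7 := dist_triangle (τ x) (τ 0) (β 0)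
      rw [dist_comm (τ 0) (β 0)] at h7
      linarith
    · push Not at hxr
      -- From T = d(β T, β 0) ≤ C + (l r(T) + e) + K one gets x ≤ r(T): the shadow has passed x by
      -- time T.
      set T := l * x + e + C + K with hT
      have hT0 : 0 ≤ T := by positivity
      have hrT : x ≤ r T := by
        have h1 := (hτ (r T) (hr0 T) 0 hI).2
        rw [Real.dist_eq, sub_zero, abs_of_nonneg (hr0 T)] at h1
        have h2 := hr T hT0
        have h3 := hβ T hT0 0 hI
        rw [sub_zero, abs_of_nonneg hT0] at h3
        have h4 := dist_triangle4 (β T) (τ (r T)) (τ 0) (β 0)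
        rw [dist_comm (τ 0) (β 0)] at h4
        have h5 : l * x ≤ l * r T := by linarith
        exact le_of_mul_le_mul_left h5 hl0
      obtain ⟨t, ht, hxt⟩ := exists_dist_le_of_mem_uIcc hl
        (hβ.mono (Set.Icc_subset_Ici_self : Set.Icc 0 T ⊆ _)) hτ hT0 (fun t _ => hr0 t)
        (fun t ht => hr t ht.1) hx (Set.mem_uIcc_of_le hxr.le hrT)
      exact ⟨β t, ⟨t, ht.1, rfl⟩, hxt.trans ((le_max_right _ _).trans (le_max_right _ _))⟩
  · rintro _ ⟨t, ht, rfl⟩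
    obtain ⟨r, hr, h⟩ := hclose t ht
    exact ⟨τ r, ⟨r, hr, rfl⟩, h.trans (le_max_left _ _)⟩

end Limits

/-! ### Uniform closeness and convergence of geodesic rays -/

section Rays

variable {X : Type*} [MetricSpace X] {p : X}

/-- The extension of a geodesic ray to the real line by a constant. -/
def Ray.ext (α : Ray p) : ℝ → X := fun t => α.1 t.toNNReal

theorem Ray.ext_coe (α : Ray p) (t : ℝ≥0) : α.ext t = α.1 t := by simp [Ray.ext]

theorem Ray.ext_zero (α : Ray p) : α.ext 0 = p := by simp [Ray.ext, α.2.2]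

theorem Ray.dist_eq (α : Ray p) (s t : ℝ≥0) : dist (α.1 s) (α.1 t) = |(s : ℝ) - t| := by
  rw [α.2.1.dist_eq, NNReal.dist_eq]

theorem Ray.dist_base (α : Ray p) (s : ℝ≥0) : dist (α.1 s) p = s := by
  have h := α.dist_eq s 0
  rwa [α.2.2, NNReal.coe_zero, sub_zero, abs_of_nonneg s.coe_nonneg] at h

theorem Ray.isGeodesicOn_ext (α : Ray p) : IsGeodesicOn α.ext (Set.Ici 0) := by
  intro s hs t ht
  change dist (α.1 _) (α.1 _) = _
  rw [α.dist_eq, Real.coe_toNNReal s hs, Real.coe_toNNReal t ht]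

theorem Ray.lipschitzWith_ext (α : Ray p) : LipschitzWith 1 α.ext := by
  refine LipschitzWith.of_dist_le_mul fun s t => ?_
  change dist (α.1 _) (α.1 _) ≤ _
  rw [α.2.1.dist_eq]
  exact lipschitzWith_iff_dist_le_mul.1 Real.lipschitzWith_toNNReal s t

theorem Ray.image_eq (α : Ray p) : α.image = α.ext '' Set.Ici 0 := by
  ext x
  constructor
  · rintro ⟨t, rfl⟩
    exact ⟨t, t.2, α.ext_coe t⟩
  · rintro ⟨t, _, rfl⟩
    exact ⟨t.toNNReal, rfl⟩

/-- The geodesic ray given by a path on the real line. -/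
def Ray.ofGeodesicOn {γ : ℝ → X} (h : IsGeodesicOn γ (Set.Ici 0)) (h0 : γ 0 = p) : Ray p :=
  ⟨fun t => γ t, Isometry.of_dist_eq fun s t => by rw [h s s.2 t t.2, NNReal.dist_eq],
    by simpa using h0⟩

theorem Ray.image_ofGeodesicOn {γ : ℝ → X} (h : IsGeodesicOn γ (Set.Ici 0)) (h0 : γ 0 = p) :
    (Ray.ofGeodesicOn h h0).image = γ '' Set.Ici 0 := by
  ext x
  constructor
  · rintro ⟨t, rfl⟩
    exact ⟨t, t.2, rfl⟩
  · rintro ⟨t, ht, rfl⟩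
    exact ⟨⟨t, ht⟩, rfl⟩

theorem Ray.cls_eq_iff {α β : Ray p} : α.cls = β.cls ↔ Asymptotic α.image β.image :=
  Quotient.eq (r := raySetoid p)

theorem Ray.asymptotic_of_dist_le {α β : Ray p} {K : ℝ} (h : ∀ t, dist (α.1 t) (β.1 t) ≤ K) :
    Asymptotic α.image β.image := by
  refine CoarselyClose.asymptotic (C := K) ⟨?_, ?_⟩
  · rintro _ ⟨t, rfl⟩
    exact ⟨_, ⟨t, rfl⟩, h t⟩
  · rintro _ ⟨t, rfl⟩
    exact ⟨_, ⟨t, rfl⟩, by rw [dist_comm]; exact h t⟩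

/-- Parameters are distances to the common base point, so those of two points at distance at most C
differ by at most C. -/
theorem Ray.dist_le_of_dist_le {α β : Ray p} {s t : ℝ≥0} {C : ℝ}
    (h : dist (β.1 t) (α.1 s) ≤ C) : dist (α.1 t) (β.1 t) ≤ 2 * C := by
  have h1 := α.dist_base s
  have h2 := β.dist_base t
  have h3 := dist_triangle (β.1 t) (α.1 s) p
  have h4 := dist_triangle (α.1 s) (β.1 t) p
  rw [dist_comm (α.1 s) (β.1 t)] at h4
  have h5 := α.dist_eq t s
  have h6 := dist_triangle (α.1 t) (α.1 s) (β.1 t)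
  rw [dist_comm (α.1 s) (β.1 t)] at h6
  have h7 : |(t : ℝ) - s| ≤ C := by rw [abs_le]; constructor <;> linarith
  linarith

/-- Two geodesic rays from the same point, one of them Morse, are uniformly close if the other one
comes back close to the Morse one again and again. -/
theorem Ray.exists_dist_le_of_frequently (hX : IsGeodesicSpace X) (N : MorseGauge) :
    ∃ K : ℝ, 0 ≤ K ∧ ∀ {p : X} {α β : Ray p}, IsMorse N α.image →
      (∃ D : ℝ, ∀ T : ℝ, ∃ t : ℝ≥0, T ≤ t ∧ ∃ s, dist (α.1 s) (β.1 t) ≤ D) →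
      ∀ t, dist (α.1 t) (β.1 t) ≤ K := by
  obtain ⟨C, hC0, hC⟩ := exists_bound_of_one_end hX N 0
  refine ⟨2 * C, by positivity, ?_⟩
  rintro p α β hα ⟨D, hD⟩ t
  obtain ⟨t', htt, s, hs⟩ := hD (t + 2 * D)
  obtain ⟨_, ⟨r, rfl⟩, hr⟩ := hC hα β.isGeodesicOn_ext isClosed_Ici Set.ordConnected_Ici
    (t₁ := 0) (t₂ := t') (D := D) (v := α.1 s) Set.self_mem_Ici t'.2
    ⟨α.1 0, ⟨0, rfl⟩, by rw [β.ext_zero, α.2.2, dist_self]⟩ ⟨s, rfl⟩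
    (by rw [β.ext_coe]; exact hs) t ⟨t.2, by linarith⟩
  rw [β.ext_coe] at hr
  exact Ray.dist_le_of_dist_le hr

/-- The Hausdorff distance of the two rays is arbitrary, while `K` depends on the gauge alone. -/
theorem Ray.exists_dist_le_of_asymptotic (hX : IsGeodesicSpace X) (N : MorseGauge) :
    ∃ K : ℝ, 0 ≤ K ∧ ∀ {p : X} {α β : Ray p}, IsMorse N α.image → Asymptotic α.image β.image →
      ∀ t, dist (α.1 t) (β.1 t) ≤ K := by
  obtain ⟨K, hK0, hK⟩ := Ray.exists_dist_le_of_frequently hX N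
  refine ⟨K, hK0, fun {p α β} hα hαβ => hK hα ?_⟩
  obtain ⟨D, hD⟩ := asymptotic_iff.1 hαβ
  refine ⟨D, fun T => ?_⟩
  obtain ⟨_, ⟨s, rfl⟩, hs⟩ := hD.2 (β.1 T.toNNReal) ⟨_, rfl⟩
  exact ⟨T.toNNReal, Real.le_coe_toNNReal T, s, by rw [dist_comm]; exact hs⟩

theorem rayTendsto_iff {β : ℕ → Ray p} {γ : Ray p} :
    RayTendsto β γ ↔ ∀ (R : ℝ≥0) (ε : ℝ), 0 < ε → ∀ᶠ n in Filter.atTop, ∀ t ≤ R,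
      dist ((β n).1 t) (γ.1 t) ≤ ε := by
  constructor
  · intro h R ε hε
    filter_upwards [Metric.tendstoUniformlyOn_iff.1 (h _ (isCompact_Icc (a := 0) (b := R))) ε hε]
      with n hn t ht
    have := hn t ⟨zero_le, ht⟩
    rw [dist_comm] at this
    exact this.le
  · intro h C hC
    rw [Metric.tendstoUniformlyOn_iff]
    intro ε hε
    obtain ⟨R, hR⟩ := hC.bddAbove
    filter_upwards [h R (ε / 2) (by linarith)] with n hn t ht
    have := hn t (hR ht)
    rw [dist_comm] at this
    linarith

theorem RayTendsto.comp {β : ℕ → Ray p} {γ : Ray p} (h : RayTendsto β γ) {φ : ℕ → ℕ}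
    (hφ : StrictMono φ) : RayTendsto (fun n => β (φ n)) γ := by
  rw [rayTendsto_iff] at h ⊢
  exact fun R ε hε => hφ.tendsto_atTop.eventually (h R ε hε)

theorem Ray.exists_subseq_tendsto [ProperSpace X] (β : ℕ → Ray p) :
    ∃ φ : ℕ → ℕ, StrictMono φ ∧ ∃ γ : Ray p, RayTendsto (fun n => β (φ n)) γ := by
  obtain ⟨φ, hφ, γ, -, hγ⟩ := MorseGeometry.exists_subseq_tendsto (fun n => (β n).ext) p 0
    (fun n => (β n).lipschitzWith_ext) fun n => by rw [Ray.ext_zero, dist_self]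
  have hgeo : IsGeodesicOn γ (Set.Ici 0) := fun s hs t ht =>
    dist_eq_of_eventually (β := fun n => (β n).ext) hγ
      (Filter.Eventually.of_forall fun n => (β (φ n)).isGeodesicOn_ext s hs t ht)
  have h0 : γ 0 = p := by
    refine eq_of_forall_dist_le fun ε hε => ?_
    obtain ⟨n, hn⟩ := (hγ 0 ε hε).exists
    have := hn 0 (by simp)
    rwa [Ray.ext_zero, dist_comm] at this
  refine ⟨φ, hφ, Ray.ofGeodesicOn hgeo h0, rayTendsto_iff.2 fun R ε hε => ?_⟩
  filter_upwards [hγ R ε hε] with n hn t ht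
  have := hn t ⟨by linarith [t.2, R.2, (NNReal.coe_le_coe.2 ht)], NNReal.coe_le_coe.2 ht⟩
  rwa [Ray.ext_coe] at this

end Rays

/-! ### Images of Morse rays under quasi-isometries -/

section Image

variable {X Y : Type*} [MetricSpace X] [MetricSpace Y]

theorem Ray.isQIEmbeddingOn_comp_ext {p : X} {f : X → Y} {l e : ℝ} (hl : 1 ≤ l)
    (hf : IsQIEmbeddingOn l e f Set.univ) (α : Ray p) :
    IsQIEmbeddingOn l e (fun t => f (α.ext t)) (Set.Ici 0) := by
  have := hf.comp hl le_rfl α.isGeodesicOn_ext.isQIEmbeddingOn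
  simpa using this

/-- The image of a Morse ray under a quasi-isometry is uniformly close to a Morse ray. -/
theorem IsQuasiIsometry.exists_ray [ProperSpace Y] (hY : IsGeodesicSpace Y) {f : X → Y}
    (hf : IsQuasiIsometry f) (p : X) (q : Y) (N : MorseGauge) :
    ∃ (N' : MorseGauge) (C : ℝ), ∀ α : Ray p, IsMorse N α.image →
      ∃ β : Ray q, IsMorse N' β.image ∧ CoarselyClose C (f '' α.image) β.image := by
  obtain ⟨N₁, hN₁⟩ := hf.exists_gauge_image N
  obtain ⟨⟨l, e, hl, he, hle⟩, -⟩ := hf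
  have hl0 : (0 : ℝ) < l := by linarith
  obtain ⟨C, hC0, hC⟩ := exists_morse_bound (X := Y) N₁ (l := 1) le_rfl 0 (dist q (f p))
  obtain ⟨C', hC'⟩ := exists_coarselyClose_of_rays (X := Y) hl he (C + 1) (dist q (f p))
  obtain ⟨N', hN'⟩ := exists_gauge_of_coarselyClose (X := Y) N₁ C'
  refine ⟨N', C', fun α hα => ?_⟩
  have hA := hN₁ _ hα
  set L : ℕ → ℝ := fun n => dist q (f (α.1 n)) with hL
  -- Both ends of the segment from q to f(α n) are within d(q, f p) of the Morse set f(α), so the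
  -- whole segment is within C of it.
  have hseg : ∀ n, ∃ c : ℝ → Y, c 0 = q ∧ LipschitzWith 1 c ∧ IsGeodesicOn c (Set.Icc 0 (L n)) ∧
      ∀ t ∈ Set.Icc 0 (L n), ∃ y ∈ f '' α.image, dist (c t) y ≤ C := by
    intro n
    obtain ⟨c, h0, h1, hc⟩ := hY.exists_segment q (f (α.1 n)) 0
    rw [zero_add] at h1 hc
    have hLn : (0 : ℝ) ≤ L n := dist_nonneg
    obtain ⟨c', hc', hcc⟩ := hc.exists_lipschitz_extension hLn
    refine ⟨c', by rw [hcc 0 ⟨le_rfl, hLn⟩, h0], hc', fun s hs t ht => ?_, fun t ht => ?_⟩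
    · rw [hcc s hs, hcc t ht, hc s hs t ht]
    · rw [hcc t ht]
      refine hC hA hc.isQIEmbeddingOn ⟨f p, ⟨p, ⟨0, α.2.2⟩, rfl⟩, by rw [h0]⟩
        ⟨f (α.1 n), ⟨_, ⟨n, rfl⟩, rfl⟩, by rw [h1, dist_self]; exact dist_nonneg⟩ t ht
  choose c hc0 hcl hcg hcA using hseg
  have hLt : Filter.Tendsto L Filter.atTop Filter.atTop := by
    have h1 : ∀ n : ℕ, 1 / l * n - e - dist q (f p) ≤ L n := by
      intro n
      have h2 := (hle (α.1 n) trivial p trivial).1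
      rw [α.dist_base, dist_comm (f (α.1 n))] at h2
      have h3 := dist_triangle (f p) q (f (α.1 n))
      rw [dist_comm (f p) q] at h3
      simp only [NNReal.coe_natCast] at h2
      simp only [hL]
      linarith
    refine Filter.tendsto_atTop_mono h1 ?_
    simp only [sub_eq_add_neg]
    exact Filter.tendsto_atTop_add_const_right _ _ (Filter.tendsto_atTop_add_const_right _ _
      (tendsto_natCast_atTop_atTop.const_mul_atTop (by positivity)))
  obtain ⟨φ, hφ, γ, -, hγ⟩ := exists_subseq_tendsto c q 0 hcl fun n => by rw [hc0, dist_self]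
  have hLφ := hLt.comp hφ.tendsto_atTop
  have hgeo : IsGeodesicOn γ (Set.Ici 0) := fun s hs t ht =>
    dist_eq_of_eventually hγ (by
      filter_upwards [hLφ.eventually_ge_atTop s, hLφ.eventually_ge_atTop t] with n h1 h2
      exact hcg (φ n) s ⟨hs, h1⟩ t ⟨ht, h2⟩)
  have h0 : γ 0 = q := by
    refine eq_of_forall_dist_le fun ε hε => ?_
    obtain ⟨n, hn⟩ := (hγ 0 ε hε).exists
    have := hn 0 (by simp)
    rwa [hc0, dist_comm] at this
  have hclose : CoarselyClose C' (f '' α.image) (γ '' Set.Ici 0) := by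
    have := hC' (α.isQIEmbeddingOn_comp_ext hl hle) hgeo (by rw [h0, α.ext_zero]) (by
      intro t ht
      obtain ⟨n, h1, h2⟩ := ((hγ t 1 one_pos).and (hLφ.eventually_ge_atTop t)).exists
      have ht0 : (0 : ℝ) ≤ t := ht
      obtain ⟨_, ⟨_, ⟨r, rfl⟩, rfl⟩, hr⟩ := hcA (φ n) t ⟨ht, h2⟩
      refine ⟨r, r.2, ?_⟩
      have h3 := h1 t ⟨by linarith, le_rfl⟩
      rw [dist_comm] at h3
      rw [α.ext_coe]
      linarith [dist_triangle (γ t) (c (φ n) t) (f (α.1 r))])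
    rwa [← Function.comp_def f, Set.image_comp, ← α.image_eq] at this
  refine ⟨Ray.ofGeodesicOn hgeo h0, ?_, ?_⟩
  · rw [Ray.image_ofGeodesicOn]
    exact hN' _ _ hA hclose
  · rwa [Ray.image_ofGeodesicOn]

/-- A fixed point of one ray has a partner on the other at a parameter bounded independently of n,
so uniform convergence on compact sets carries the common constant `C` to the limit. -/
theorem IsQuasiIsometry.asymptotic_of_rayTendsto {f : X → Y} (hf : IsQuasiIsometry f) {p : X}
    {q : Y} {β : ℕ → Ray p} {γ : Ray p} {δ : ℕ → Ray q} {η : Ray q} {C : ℝ}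
    (hC : ∀ n, CoarselyClose C (f '' (β n).image) (δ n).image) (hβ : RayTendsto β γ)
    (hδ : RayTendsto δ η) : Asymptotic (f '' γ.image) η.image := by
  obtain ⟨⟨l, e, hl, he, hle⟩, -⟩ := hf
  have hl0 : (0 : ℝ) < l := by linarith
  rw [rayTendsto_iff] at hβ hδ
  have hf' : ∀ x y, dist x y ≤ 1 → dist (f x) (f y) ≤ l + e := by
    intro x y hxy
    have h1 := (hle x trivial y trivial).2
    nlinarith
  refine CoarselyClose.asymptotic (C := l + e + C + 1) ⟨?_, ?_⟩
  · rintro _ ⟨_, ⟨t, rfl⟩, rfl⟩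
    set R : ℝ := C + l * t + e + dist (f p) q with hR
    obtain ⟨n, h1, h2⟩ := ((hβ t 1 one_pos).and (hδ R.toNNReal 1 one_pos)).exists
    obtain ⟨_, ⟨s, rfl⟩, hs⟩ := (hC n).1 (f ((β n).1 t)) ⟨_, ⟨t, rfl⟩, rfl⟩
    have h3 := hf' _ _ (h1 t le_rfl)
    have h4 : s ≤ R.toNNReal := by
      rw [← NNReal.coe_le_coe]
      refine le_trans ?_ (Real.le_coe_toNNReal R)
      rw [← (δ n).dist_base s]
      have h5 := (hle ((β n).1 t) trivial p trivial).2
      rw [(β n).dist_base] at h5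
      have h6 := dist_triangle4 ((δ n).1 s) (f ((β n).1 t)) (f p) q
      rw [dist_comm ((δ n).1 s) (f ((β n).1 t))] at h6
      linarith
    refine ⟨_, ⟨s, rfl⟩, ?_⟩
    have h5 := h2 s h4
    have h6 := dist_triangle4 (f (γ.1 t)) (f ((β n).1 t)) ((δ n).1 s) (η.1 s)
    rw [dist_comm (f (γ.1 t)) (f ((β n).1 t))] at h6
    linarith
  · rintro _ ⟨s, rfl⟩
    set R : ℝ := l * (C + s + dist (f p) q + e) with hR
    obtain ⟨n, h1, h2⟩ := ((hβ R.toNNReal 1 one_pos).and (hδ s 1 one_pos)).exists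
    obtain ⟨_, ⟨_, ⟨t, rfl⟩, rfl⟩, ht⟩ := (hC n).2 ((δ n).1 s) ⟨s, rfl⟩
    have h4 : t ≤ R.toNNReal := by
      rw [← NNReal.coe_le_coe]
      refine le_trans ?_ (Real.le_coe_toNNReal R)
      rw [← (β n).dist_base t]
      refine (hle.dist_le hl0 (Set.mem_univ _) (Set.mem_univ _)).trans
        (mul_le_mul_of_nonneg_left ?_ hl0.le)
      have h5 := (δ n).dist_base s
      have h6 := dist_triangle4 (f ((β n).1 t)) ((δ n).1 s) q (f p)
      rw [dist_comm (f ((β n).1 t)) ((δ n).1 s), dist_comm q (f p)] at h6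
      linarith
    refine ⟨_, ⟨_, ⟨t, rfl⟩, rfl⟩, ?_⟩
    have h3 := hf' _ _ (h1 t h4)
    have h5 := h2 s le_rfl
    have h6 := dist_triangle4 (η.1 s) ((δ n).1 s) (f ((β n).1 t)) (f (γ.1 t))
    rw [dist_comm (η.1 s) ((δ n).1 s)] at h6
    linarith

end Image

/-! ### Limits of rays in a stratum -/

section LimitRays

variable {X : Type*} [MetricSpace X]

/-- The rays that are limits of `N`-Morse rays, uniformly on compact sets. -/
def limitRays (p : X) (N : MorseGauge) : Set (Ray p) :=
  {α | ∀ (R : ℝ≥0) (ε : ℝ), 0 < ε →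
    ∃ α' : Ray p, IsMorse N α'.image ∧ ∀ t ≤ R, dist (α.1 t) (α'.1 t) ≤ ε}

/-- The approximating ray may depend on the point of the quasi-geodesic being tested: it is taken
close enough, for long enough, to cover the endpoints and the nearby Morse point. The bound C + 1
does not involve this length. -/
theorem exists_gauge_limitRays (p : X) (N : MorseGauge) :
    ∃ M : MorseGauge, ∀ α ∈ limitRays p N, IsMorse M α.image := by
  suffices h : ∃ M : MorseGauge, ∀ B : Set X, (∃ α ∈ limitRays p N, α.image = B) →
      IsMorse M B by
    obtain ⟨M, hM⟩ := h
    exact ⟨M, fun α hα => hM _ ⟨α, hα, rfl⟩⟩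
  refine exists_gauge fun l hl e he => ?_
  obtain ⟨C, hC0, hC⟩ := exists_morse_bound (X := X) N hl e 1
  refine ⟨C + 1, ?_⟩
  rintro _ ⟨α, hα, rfl⟩ a b σ hab hσ ⟨x, hx⟩ ⟨y, hy⟩ t ht
  set R : ℝ≥0 := max (max x y) (C + dist (σ t) p).toNNReal with hR
  obtain ⟨α', hα', h⟩ := hα R 1 one_pos
  obtain ⟨_, ⟨s, rfl⟩, hs⟩ := hC hα' hσ
    ⟨α'.1 x, ⟨x, rfl⟩, by rw [← hx]; exact h x ((le_max_left _ _).trans (le_max_left _ _))⟩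
    ⟨α'.1 y, ⟨y, rfl⟩, by rw [← hy]; exact h y ((le_max_right _ _).trans (le_max_left _ _))⟩ t ht
  have h1 : s ≤ R := by
    refine le_trans ?_ (le_max_right _ _)
    rw [← NNReal.coe_le_coe]
    refine le_trans ?_ (Real.le_coe_toNNReal _)
    rw [← α'.dist_base s]
    have := dist_triangle (α'.1 s) (σ t) p
    rw [dist_comm (α'.1 s) (σ t)] at this
    linarith
  refine ⟨α.1 s, ⟨s, rfl⟩, ?_⟩
  have h2 := h s h1
  have h3 := dist_triangle (σ t) (α'.1 s) (α.1 s)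
  rw [dist_comm (α'.1 s) (α.1 s)] at h3
  linarith

theorem RayTendsto.mem_limitRays {p : X} {N : MorseGauge} {α : ℕ → Ray p} {γ : Ray p}
    (h : RayTendsto α γ) (hα : ∀ n, α n ∈ limitRays p N) : γ ∈ limitRays p N := by
  intro R ε hε
  obtain ⟨n, hn⟩ := (rayTendsto_iff.1 h R (ε / 2) (by linarith)).exists
  obtain ⟨α', h1, h2⟩ := hα n R (ε / 2) (by linarith)
  refine ⟨α', h1, fun t ht => ?_⟩
  have h3 := hn t ht
  have h4 := h2 t ht
  have h5 := dist_triangle (γ.1 t) ((α n).1 t) (α'.1 t)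
  rw [dist_comm (γ.1 t) ((α n).1 t)] at h5
  linarith

/-- The given representatives need not be limit rays. They are replaced by asymptotic limit rays,
which are uniformly close since all of these are `M`-Morse; a limit of the replacements is again a
limit ray, asymptotic to the limit of the originals. -/
theorem isVisuallyClosed_limitRays [ProperSpace X] (hX : IsGeodesicSpace X) (p : X)
    (N : MorseGauge) : IsVisuallyClosed (Ray.cls '' limitRays p N) := by
  intro β b hβ hb
  obtain ⟨M, hM⟩ := exists_gauge_limitRays p N
  obtain ⟨K, hK0, hK⟩ := Ray.exists_dist_le_of_asymptotic hX M
  choose α hα hαβ using hβ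
  obtain ⟨φ, hφ, γ, hγb, hγ⟩ := hb id strictMono_id
  obtain ⟨ψ, hψ, η, hη⟩ := Ray.exists_subseq_tendsto fun n => α (φ n)
  refine ⟨η, hη.mem_limitRays fun n => hα _, ?_⟩
  rw [← hγb, Ray.cls_eq_iff]
  have h1 : ∀ n, CoarselyClose K ((fun x => x) '' (α (φ (ψ n))).image) (β (φ (ψ n))).image := by
    intro n
    have h := hK (hM _ (hα (φ (ψ n)))) (Ray.cls_eq_iff.1 (hαβ (φ (ψ n))))
    rw [Set.image_id']
    constructor
    · rintro _ ⟨t, rfl⟩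
      exact ⟨_, ⟨t, rfl⟩, h t⟩
    · rintro _ ⟨t, rfl⟩
      exact ⟨_, ⟨t, rfl⟩, by rw [dist_comm]; exact h t⟩
  have := IsQuasiIsometry.refl.asymptotic_of_rayTendsto h1 hη (hγ.comp hψ)
  rwa [Set.image_id'] at this

end LimitRays

/-! ### Bi-infinite geodesics between Morse boundary points -/

section Lines

variable {X Y : Type*} [MetricSpace X] [MetricSpace Y]

theorem image_comp_neg {Z : Type*} (γ : ℝ → Z) (J : Set ℝ) : (fun t => γ (-t)) '' J = γ '' (Neg.neg '' J) := by
  rw [Set.image_image]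

theorem image_comp_neg_Ici {Z : Type*} (γ : ℝ → Z) : (fun t => γ (-t)) '' Set.Ici 0 = γ '' Set.Iic 0 := by
  rw [image_comp_neg, Set.image_neg_eq_neg, Set.neg_Ici, neg_zero]

theorem isometry_comp_neg {γ : ℝ → X} (h : Isometry γ) : Isometry fun t => γ (-t) :=
  h.comp (IsometryEquiv.neg ℝ).isometry

theorem IsMorseLine.comp_neg {N : MorseGauge} {γ : ℝ → X} (h : IsMorseLine N γ) :
    IsMorseLine N fun t => γ (-t) := by
  intro J hJ hJo
  rw [image_comp_neg, Set.image_neg_eq_neg]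
  refine h _ hJ.neg ⟨fun x hx y hy z hz => ?_⟩
  exact hJo.out (Set.mem_neg.1 hy) (Set.mem_neg.1 hx) ⟨neg_le_neg hz.2, neg_le_neg hz.1⟩

theorem IsMorseLine.range {N : MorseGauge} {γ : ℝ → X} (h : IsMorseLine N γ) :
    IsMorse N (Set.range γ) := by
  rw [← Set.image_univ]
  exact h _ isClosed_univ Set.ordConnected_univ

/-- One-sided closeness suffices, since a geodesic ray near `α` cannot skip a large part of it. The
resulting constant also depends on the distance from γ 0 to p. -/
theorem IsGeodesicOn.asymptotic_of_near_ray {p : X} {γ : ℝ → X} (hγ : IsGeodesicOn γ (Set.Ici 0))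
    {α : Ray p} {C : ℝ} (h : ∀ t ∈ Set.Ici (0 : ℝ), ∃ y ∈ α.image, dist (γ t) y ≤ C) :
    Asymptotic (γ '' Set.Ici 0) α.image := by
  obtain ⟨C', hC'⟩ := exists_coarselyClose_of_rays (X := X) (l := 1) (e := 0) le_rfl le_rfl C
    (dist (γ 0) p)
  rw [α.image_eq] at h ⊢
  refine (hC' α.isGeodesicOn_ext.isQIEmbeddingOn hγ (by rw [α.ext_zero]) fun t ht => ?_).symm.asymptotic
  obtain ⟨_, ⟨r, hr, rfl⟩, h'⟩ := h t ht
  exact ⟨r, hr, h'⟩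

/-- Geodesic segments between two Morse rays from the same point, split at a nearest point to the
common starting point. -/
theorem exists_segment_between_rays (hX : IsGeodesicSpace X) {p : X} {α β : Ray p}
    {Na Nb : MorseGauge} (hα : IsMorse Na α.image) (hβ : IsMorse Nb β.image) :
    ∃ C : ℝ, ∀ x ∈ α.image, ∀ y ∈ β.image, ∃ (c : ℝ → X) (u v : ℝ), 0 ≤ u ∧ 0 ≤ v ∧
      LipschitzWith 1 c ∧ IsGeodesicOn c (Set.Icc (-u) v) ∧ c (-u) = x ∧ c v = y ∧
      (∀ t ∈ Set.Icc (-u) 0, ∃ z ∈ α.image, dist (c t) z ≤ C) ∧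
      ∀ t ∈ Set.Icc 0 v, ∃ z ∈ β.image, dist (c t) z ≤ C := by
  obtain ⟨Ca, -, hCa⟩ := exists_bound_of_nearest hX Na 0
  obtain ⟨Cb, -, hCb⟩ := exists_bound_of_nearest hX Nb 0
  refine ⟨max Ca Cb, fun x hx y hy => ?_⟩
  obtain ⟨c, h0, h1, hc⟩ := hX.exists_segment x y 0
  rw [zero_add] at h1 hc
  set L := dist x y
  have hL : 0 ≤ L := dist_nonneg
  obtain ⟨s, hs, hn⟩ := hc.exists_nearest isClosed_Icc ⟨0, le_rfl, hL⟩ p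
  obtain ⟨c', hc', hcc⟩ := hc.exists_lipschitz_extension hL
  have hmem : ∀ t ∈ Set.Icc (-s) (L - s), t + s ∈ Set.Icc 0 L := fun t ht =>
    ⟨by linarith [ht.1], by linarith [ht.2]⟩
  have heq : ∀ t ∈ Set.Icc (-s) (L - s), c' (t + s) = c (t + s) := fun t ht => hcc _ (hmem t ht)
  have hs0 := hs.1
  have hsL := hs.2
  have hpα : ∃ y ∈ α.image, dist p y ≤ 0 := ⟨p, ⟨0, α.2.2⟩, by rw [dist_self]⟩
  have hpβ : ∃ y ∈ β.image, dist p y ≤ 0 := ⟨p, ⟨0, β.2.2⟩, by rw [dist_self]⟩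
  refine ⟨fun t => c' (t + s), s, L - s, hs0, by linarith, ?_, ?_, ?_, ?_, ?_, ?_⟩
  · refine LipschitzWith.of_dist_le_mul fun t t' => ?_
    simpa using hc'.dist_le_mul (t + s) (t' + s)
  · intro t ht t' ht'
    simp only [heq t ht, heq t' ht', hc _ (hmem t ht) _ (hmem t' ht')]
    ring_nf
  · simp only [neg_add_cancel, hcc 0 ⟨le_rfl, hL⟩, h0]
  · simp only [sub_add_cancel, hcc L ⟨hL, le_rfl⟩, h1]
  · intro t ht
    simp only [heq t ⟨ht.1, by linarith [ht.2]⟩]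
    obtain ⟨z, hz, h⟩ := hCa hα hc Set.ordConnected_Icc hs ⟨le_rfl, hL⟩ hn hpα
      ⟨x, hx, by rw [h0, dist_self]⟩ (t + s)
      (Set.mem_uIcc_of_ge (by linarith [ht.1]) (by linarith [ht.2]))
    exact ⟨z, hz, h.trans (le_max_left _ _)⟩
  · intro t ht
    simp only [heq t ⟨by linarith [ht.1], ht.2⟩]
    obtain ⟨z, hz, h⟩ := hCb hβ hc Set.ordConnected_Icc hs ⟨hL, le_rfl⟩ hn hpβ
      ⟨y, hy, by rw [h1, dist_self]⟩ (t + s)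
      (Set.mem_uIcc_of_le (by linarith [ht.1]) (by linarith [ht.2]))
    exact ⟨z, hz, h.trans (le_max_right _ _)⟩

/-- Distinct points of the Morse boundary are joined by a geodesic line. -/
theorem exists_isLineFromTo [ProperSpace X] (hX : IsGeodesicSpace X) {p : X}
    {a b : MorseBoundary p} (hab : a ≠ b) : ∃ γ : ℝ → X, IsLineFromTo γ a b := by
  obtain ⟨Na, α, hαa, hα⟩ := a.2
  obtain ⟨Nb, β, hβb, hβ⟩ := b.2
  obtain ⟨C, hC⟩ := exists_segment_between_rays hX hα hβ
  choose c u v hu hv hlip hgeo hcu hcv hcα hcβ using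
    fun n : ℕ => hC (α.1 n) ⟨n, rfl⟩ (β.1 n) ⟨n, rfl⟩
  -- The point c n 0 is near both rays. If it escaped to infinity, `β` would come within 2C of `α`
  -- arbitrarily far out, forcing a = b.
  have hbdd : ∃ R, ∀ n, dist (c n 0) p ≤ R := by
    by_contra! hcon
    obtain ⟨K, -, hK⟩ := Ray.exists_dist_le_of_frequently hX Na
    refine hab (Subtype.ext ?_)
    rw [← hαa, ← hβb, Ray.cls_eq_iff]
    refine Ray.asymptotic_of_dist_le (hK hα ⟨2 * C, fun T => ?_⟩)
    obtain ⟨n, hn⟩ := hcon (T + C)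
    obtain ⟨_, ⟨s, rfl⟩, hs⟩ := hcα n 0 ⟨by linarith [hu n], le_rfl⟩
    obtain ⟨_, ⟨t, rfl⟩, ht⟩ := hcβ n 0 ⟨le_rfl, hv n⟩
    refine ⟨t, ?_, s, ?_⟩
    · rw [← β.dist_base t]
      linarith [dist_triangle (c n 0) (β.1 t) p]
    · rw [dist_comm] at hs
      linarith [dist_triangle (α.1 s) (c n 0) (β.1 t)]
  obtain ⟨R, hR⟩ := hbdd
  have hun : ∀ n : ℕ, (n : ℝ) - R ≤ u n := by
    intro n
    have h1 := (hgeo n).dist_of_le (s := -u n) (t := 0) ⟨le_rfl, by linarith [hu n, hv n]⟩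
      ⟨by linarith [hu n], hv n⟩ (by linarith [hu n])
    have h2 := α.dist_base n
    rw [← hcu] at h2
    simp only [NNReal.coe_natCast] at h2
    linarith [dist_triangle (c n (-u n)) (c n 0) p, hR n]
  have hvn : ∀ n : ℕ, (n : ℝ) - R ≤ v n := by
    intro n
    have h1 := (hgeo n).dist_of_le (s := 0) (t := v n) ⟨by linarith [hu n], hv n⟩
      ⟨by linarith [hu n, hv n], le_rfl⟩ (hv n)
    have h2 := β.dist_base n
    rw [← hcv] at h2
    simp only [NNReal.coe_natCast] at h2
    rw [dist_comm] at h1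
    linarith [dist_triangle (c n (v n)) (c n 0) p, hR n]
  obtain ⟨φ, hφ, γ, -, hγ⟩ := exists_subseq_tendsto c p R hlip hR
  have hlarge : ∀ t : ℝ, ∀ᶠ n in Filter.atTop, t ∈ Set.Icc (-u (φ n)) (v (φ n)) := by
    intro t
    filter_upwards [(tendsto_natCast_atTop_atTop (R := ℝ)).comp hφ.tendsto_atTop
      |>.eventually_ge_atTop (|t| + R)] with n hn
    simp only [Function.comp_apply] at hn
    have := abs_le.1 (le_refl |t|)
    exact ⟨by linarith [hun (φ n)], by linarith [hvn (φ n)]⟩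
  have hiso : Isometry γ := Isometry.of_dist_eq fun s t => by
    rw [Real.dist_eq]
    refine dist_eq_of_eventually hγ ?_
    filter_upwards [hlarge s, hlarge t] with n hs ht
    exact hgeo (φ n) s hs t ht
  have hnear : ∀ t : ℝ, ∃ n, t ∈ Set.Icc (-u (φ n)) (v (φ n)) ∧ dist (γ t) (c (φ n) t) ≤ 1 := by
    intro t
    obtain ⟨n, h1, h2⟩ := ((hγ |t| 1 one_pos).and (hlarge t)).exists
    exact ⟨n, h2, by rw [dist_comm]; exact h1 t (abs_le.1 le_rfl)⟩
  refine ⟨γ, hiso, ⟨α, hαa, ?_⟩, β, hβb, ?_⟩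
  · rw [← image_comp_neg_Ici]
    refine (isGeodesicOn_of_isometry (isometry_comp_neg hiso) _).asymptotic_of_near_ray
      (C := C + 1) fun t ht => ?_
    obtain ⟨n, h1, h2⟩ := hnear (-t)
    obtain ⟨z, hz, h3⟩ := hcα (φ n) (-t) ⟨h1.1, neg_nonpos.2 ht⟩
    exact ⟨z, hz, by linarith [dist_triangle (γ (-t)) (c (φ n) (-t)) z]⟩
  · refine (isGeodesicOn_of_isometry hiso _).asymptotic_of_near_ray (C := C + 1) fun t ht => ?_
    obtain ⟨n, h1, h2⟩ := hnear t
    obtain ⟨z, hz, h3⟩ := hcβ (φ n) t ⟨ht, h1.2⟩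
    exact ⟨z, hz, by linarith [dist_triangle (γ t) (c (φ n) t) z]⟩

/-- A geodesic line with the same ends as the image of a Morse line under a quasi-isometry is
uniformly close to this image. -/
theorem IsQuasiIsometry.exists_coarselyClose_line (hY : IsGeodesicSpace Y) {f : X → Y}
    (hf : IsQuasiIsometry f) (N : MorseGauge) :
    ∃ (C : ℝ) (N' : MorseGauge), ∀ {γ : ℝ → X} {η : ℝ → Y}, Isometry γ → IsMorse N (Set.range γ) →
      Isometry η → Asymptotic (f '' (γ '' Set.Iic 0)) (η '' Set.Iic 0) →
      Asymptotic (f '' (γ '' Set.Ici 0)) (η '' Set.Ici 0) →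
      CoarselyClose C (f '' Set.range γ) (Set.range η) ∧ IsMorseLine N' η := by
  obtain ⟨N₁, hN₁⟩ := hf.exists_gauge_image N
  obtain ⟨⟨l, e, hl, he, hle⟩, -⟩ := hf
  have hl0 : (0 : ℝ) < l := by linarith
  obtain ⟨C, hC0, hC⟩ := exists_bound_of_two_ends hY N₁
  set C' := max C (l * (l * (1 + 2 * C + e)) + e + C)
  obtain ⟨N₂, hN₂⟩ := exists_gauge_of_coarselyClose (X := Y) N₁ C'
  obtain ⟨N', hN'⟩ := exists_gauge_isMorseLine (X := Y) N₂
  refine ⟨C', N', fun {γ η} hγ hγM hη hneg hpos => ?_⟩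
  suffices h : CoarselyClose C' (f '' Set.range γ) (Set.range η) from
    ⟨h, hN' η hη (hN₂ _ _ (hN₁ _ hγM) h)⟩
  obtain ⟨D₁, hD₁⟩ := asymptotic_iff.1 hneg
  obtain ⟨D₂, hD₂⟩ := asymptotic_iff.1 hpos
  set D := max D₁ D₂
  have hgeo := isGeodesicOn_of_isometry hη Set.univ
  have hD0 : 0 ≤ D := by
    obtain ⟨y, -, hy⟩ := hD₁.2 (η 0) ⟨0, Set.self_mem_Iic, rfl⟩
    exact dist_nonneg.trans (hy.trans (le_max_left _ _))
  have hclose : ∀ t, ∃ r, dist (η t) (f (γ r)) ≤ C := by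
    intro t
    have ht := abs_le.1 (le_refl |t|)
    -- The unknown distance D of the ends is absorbed by going out to ±(|t| + 8D), where the
    -- two-ends bound applies with C independent of D.
    obtain ⟨_, ⟨_, ⟨r₁, -, rfl⟩, rfl⟩, h₁⟩ := hD₁.2 (η (-(|t| + 8 * D)))
      ⟨_, by rw [Set.mem_Iic]; linarith, rfl⟩
    obtain ⟨_, ⟨_, ⟨r₂, -, rfl⟩, rfl⟩, h₂⟩ := hD₂.2 (η (|t| + 8 * D))
      ⟨_, by rw [Set.mem_Ici]; linarith, rfl⟩
    obtain ⟨_, ⟨_, ⟨r, rfl⟩, rfl⟩, h⟩ := hC (hN₁ _ hγM) hgeo isClosed_univ Set.ordConnected_univ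
      (t₁ := -(|t| + 8 * D)) (t₂ := |t| + 8 * D) (D := D) trivial trivial
      ⟨_, ⟨r₁, rfl⟩, rfl⟩ ⟨_, ⟨r₂, rfl⟩, rfl⟩
      (by rw [dist_comm]; exact h₁.trans (le_max_left _ _))
      (by rw [dist_comm]; exact h₂.trans (le_max_right _ _)) (by linarith) t
      ⟨by linarith, by linarith⟩
    exact ⟨r, h⟩
  choose r hr using hclose
  have hτ : IsQIEmbeddingOn l e (fun t => f (γ t)) Set.univ := by
    simpa using hle.comp hl le_rfl (isGeodesicOn_of_isometry hγ Set.univ).isQIEmbeddingOn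
  constructor
  · rintro _ ⟨_, ⟨x, rfl⟩, rfl⟩
    have hx := abs_le.1 (le_refl |x|)
    set M := l * (C + D + e)
    have hM0 : 0 ≤ M := by positivity
    have key : ∀ t x', dist (f (γ x')) (η t) ≤ D → |r t - x'| ≤ M := by
      intro t x' h
      have h1 := hτ.dist_le hl0 (Set.mem_univ (r t)) (Set.mem_univ x')
      rw [Real.dist_eq] at h1
      refine h1.trans (mul_le_mul_of_nonneg_left ?_ hl0.le)
      have h2 := dist_triangle (f (γ (r t))) (η t) (f (γ x'))
      have h3 := hr t
      rw [dist_comm (f (γ (r t))) (η t), dist_comm (η t) (f (γ x'))] at h2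
      linarith
    -- The margin M compensates for the error of r at the partners t₁ and t₂, so that r t₁ ≤ x ≤ r
    -- t₂. As D enters only through M, it does not affect the final bound.
    obtain ⟨_, ⟨t₁, ht₁, rfl⟩, h₁⟩ := hD₁.1 (f (γ (-(|x| + M))))
      ⟨_, ⟨_, by rw [Set.mem_Iic]; linarith, rfl⟩, rfl⟩
    obtain ⟨_, ⟨t₂, ht₂, rfl⟩, h₂⟩ := hD₂.1 (f (γ (|x| + M)))
      ⟨_, ⟨_, by rw [Set.mem_Ici]; linarith, rfl⟩, rfl⟩
    have k₁ := abs_le.1 (key _ _ (h₁.trans (le_max_left _ _)))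
    have k₂ := abs_le.1 (key _ _ (h₂.trans (le_max_right _ _)))
    obtain ⟨t, -, ht⟩ := exists_dist_le_of_mem_uIcc (x := x) hl
      (isGeodesicOn_of_isometry hη (Set.Icc t₁ t₂)) hτ
      (le_trans (Set.mem_Iic.1 ht₁) (Set.mem_Ici.1 ht₂)) (fun _ _ => trivial) (fun t _ => hr t)
      trivial (Set.mem_uIcc_of_le (by linarith) (by linarith))
    exact ⟨η t, ⟨t, rfl⟩, ht.trans (le_max_right _ _)⟩
  · rintro _ ⟨t, rfl⟩
    exact ⟨_, ⟨_, ⟨r t, rfl⟩, rfl⟩, (hr t).trans (le_max_left _ _)⟩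

theorem IsInducedBy.exists_coarselyClose_line (hY : IsGeodesicSpace Y) {f : X → Y}
    (hf : IsQuasiIsometry f) {p : X} {q : Y} {h : MorseBoundary p → MorseBoundary q}
    (hfh : IsInducedBy f h) (N : MorseGauge) :
    ∃ (C : ℝ) (N' : MorseGauge), ∀ {a b : MorseBoundary p} {γ : ℝ → X} {η : ℝ → Y},
      IsLineFromTo γ a b → IsMorseLine N γ → IsLineFromTo η (h a) (h b) →
      CoarselyClose C (f '' Set.range γ) (Set.range η) ∧ IsMorseLine N' η := by
  obtain ⟨C, N', hC⟩ := hf.exists_coarselyClose_line hY N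
  refine ⟨C, N', ?_⟩
  rintro a b γ η ⟨hγ, ⟨α, hα, hγα⟩, β, hβ, hγβ⟩ hγM ⟨hη, ⟨α', hα', hηα⟩, β', hβ', hηβ⟩
  exact hC hγ hγM.range hη ((hγα.image hf).trans ((hfh a α α' hα hα').trans hηα.symm))
    ((hγβ.image hf).trans ((hfh b β β' hβ hβ').trans hηβ.symm))

end Lines

/-! ### Ideal triangles and coarse uniqueness of centers -/

section Triangles

variable {X : Type*} [MetricSpace X]

theorem asymptotic_of_rays {p : X} {a : MorseBoundary p} {A B : Set X}
    (hA : ∃ α : Ray p, α.cls = a.1 ∧ Asymptotic A α.image)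
    (hB : ∃ α : Ray p, α.cls = a.1 ∧ Asymptotic B α.image) : Asymptotic A B := by
  obtain ⟨α, h1, h2⟩ := hA
  obtain ⟨β, h3, h4⟩ := hB
  exact h2.trans ((Ray.cls_eq_iff.1 (h1.trans h3.symm)).trans h4.symm)

/-- A stretch of length 8D on the common end, with D the unknown Hausdorff distance, already
contains a point within the uniform bound `C`. -/
theorem exists_dist_le_of_asymptotic_ends (hX : IsGeodesicSpace X) (N : MorseGauge) :
    ∃ C : ℝ, 0 ≤ C ∧ ∀ {γ η : ℝ → X} {S J : Set ℝ}, IsMorse N (Set.range γ) → Isometry η →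
      (J = Set.Iic 0 ∨ J = Set.Ici 0) → Asymptotic (γ '' S) (η '' J) →
      ∃ s t, dist (γ s) (η t) ≤ C := by
  obtain ⟨C, hC0, hC⟩ := exists_bound_of_two_ends hX N
  refine ⟨C, hC0, fun {γ η S J} hγ hη hJ h => ?_⟩
  obtain ⟨D, hD⟩ := asymptotic_iff.1 h
  have h0 : (0 : ℝ) ∈ J := by rcases hJ with rfl | rfl <;> simp
  obtain ⟨_, ⟨s₀, -, rfl⟩, hs₀⟩ := hD.2 (η 0) ⟨0, h0, rfl⟩
  have hD0 : 0 ≤ D := dist_nonneg.trans hs₀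
  have hex : ∃ t₁ ∈ J, t₁ + 8 * D ∈ J := by
    rcases hJ with rfl | rfl
    · exact ⟨-(8 * D), by rw [Set.mem_Iic]; linarith, by simp⟩
    · exact ⟨0, by simp, by rw [Set.mem_Ici]; linarith⟩
  obtain ⟨t₁, ht₁, ht₂⟩ := hex
  obtain ⟨_, ⟨s₁, -, rfl⟩, h₁⟩ := hD.2 _ ⟨t₁, ht₁, rfl⟩
  obtain ⟨_, ⟨s₂, -, rfl⟩, h₂⟩ := hD.2 _ ⟨_, ht₂, rfl⟩
  obtain ⟨_, ⟨s, rfl⟩, hs⟩ := hC hγ (isGeodesicOn_of_isometry hη Set.univ) isClosed_univ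
    Set.ordConnected_univ trivial trivial ⟨s₁, rfl⟩ ⟨s₂, rfl⟩ (by rwa [dist_comm])
    (by rwa [dist_comm]) le_rfl (t₁ + 2 * D) ⟨le_rfl, by linarith⟩
  exact ⟨s, _, by rwa [dist_comm]⟩

/-- Ideal triangles with Morse sides have internal triples of uniform size. -/
theorem exists_isInternalConstant (hX : IsGeodesicSpace X) (p : X)
    (N : MorseGauge) : ∃ K : ℝ, IsInternalConstant p N K := by
  obtain ⟨D, hD0, hD⟩ := exists_dist_le_of_asymptotic_ends hX N
  obtain ⟨C, hC0, hC⟩ := exists_bound_of_nearest hX N D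
  refine ⟨2 * C + 1, by positivity, ?_⟩
  rintro a b c γ₁ γ₂ γ₃ ⟨⟨hγ₁, h₁a, h₁b⟩, ⟨hγ₂, h₂b, h₂c⟩, ⟨hγ₃, h₃a, h₃c⟩⟩ hM₁ hM₂ hM₃
  obtain ⟨s₁, t₁, ha⟩ := hD hM₁.range hγ₃ (Or.inl rfl) (asymptotic_of_rays h₁a h₃a)
  obtain ⟨s₂, t₂, hb⟩ := hD hM₁.range hγ₂ (Or.inl rfl) (asymptotic_of_rays h₁b h₂b)
  obtain ⟨s₃, t₃, hc⟩ := hD hM₂.range hγ₃ (Or.inr rfl) (asymptotic_of_rays h₂c h₃c)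
  have hgeo := isGeodesicOn_of_isometry hγ₃ Set.univ
  -- A point near the vertex b, close to both γ₁ and γ₂, is projected to γ₃. The part of γ₃ from the
  -- projection towards a is near γ₁ and the part towards c is near γ₂, so the projection itself is
  -- near both.
  obtain ⟨r, -, hr⟩ := hgeo.exists_nearest isClosed_univ ⟨0, trivial⟩ (γ₁ s₂)
  obtain ⟨_, ⟨u, rfl⟩, hu⟩ := hC hM₁.range hgeo Set.ordConnected_univ trivial trivial hr
    ⟨_, ⟨s₂, rfl⟩, by rwa [dist_self]⟩ ⟨_, ⟨s₁, rfl⟩, by rwa [dist_comm]⟩ r Set.left_mem_uIcc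
  obtain ⟨_, ⟨v, rfl⟩, hv⟩ := hC hM₂.range hgeo Set.ordConnected_univ trivial trivial hr
    ⟨_, ⟨t₂, rfl⟩, hb⟩ ⟨_, ⟨s₃, rfl⟩, by rwa [dist_comm]⟩ r Set.left_mem_uIcc
  have := dist_triangle (γ₁ u) (γ₃ r) (γ₂ v)
  rw [dist_comm] at hu
  refine ⟨u, v, r, by linarith, by rw [dist_comm]; linarith, by linarith⟩

/-- Two asymptotic Morse lines that pass near two points in different orders: the points are
uniformly close. -/
theorem exists_dist_le_of_opposite (hX : IsGeodesicSpace X) (N : MorseGauge) (K : ℝ) :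
    ∃ C : ℝ, ∀ {γ η : ℝ → X}, Isometry γ → Isometry η → IsMorseLine N η →
      Asymptotic (γ '' Set.Ici 0) (η '' Set.Ici 0) → ∀ {x x' : X} {s s' u u' : ℝ},
      dist x (γ s) ≤ K → dist x (η u) ≤ K → dist x' (γ s') ≤ K → dist x' (η u') ≤ K →
      s ≤ s' → u' ≤ u → dist x x' ≤ C := by
  obtain ⟨C, hC0, hC⟩ := exists_bound_of_one_end hX N (2 * K)
  refine ⟨C + 4 * K, fun {γ η} hγ hη hM has {x x' s s' u u'} h1 h2 h3 h4 hs hu => ?_⟩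
  obtain ⟨D, hD⟩ := asymptotic_iff.1 has
  have hD0 : 0 ≤ D := by
    obtain ⟨y, -, hy⟩ := hD.2 (η 0) ⟨0, Set.self_mem_Ici, rfl⟩
    exact dist_nonneg.trans hy
  have hK0 : 0 ≤ K := dist_nonneg.trans h1
  have hsu : dist (γ s) (η u) ≤ 2 * K := by
    have := dist_triangle (γ s) x (η u)
    rw [dist_comm (γ s) x] at this
    linarith
  set t₂ := |s| + |s'| + |u| + 2 * D + 2 * K + 1 with ht₂
  have hsabs := abs_le.1 (le_refl |s|)
  have hsabs' := abs_le.1 (le_refl |s'|)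
  have huabs := abs_le.1 (le_refl |u|)
  obtain ⟨_, ⟨r, hr, rfl⟩, hrD⟩ := hD.1 (γ t₂) ⟨t₂, by rw [Set.mem_Ici]; linarith, rfl⟩
  -- The point γ t₂ is so far from γ s that its partner on the positive half of `η` cannot lie
  -- before u.
  have hru : u ≤ r := by
    by_contra! hcon
    have e1 := hγ.dist_eq s t₂
    have e2 := hη.dist_eq u r
    rw [Real.dist_eq, abs_of_nonpos (by linarith)] at e1
    rw [Real.dist_eq, abs_of_nonneg (by linarith)] at e2
    have e3 := dist_triangle4 (γ s) (η u) (η r) (γ t₂)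
    rw [dist_comm (η r)] at e3
    have hr0 : (0 : ℝ) ≤ r := hr
    linarith
  -- The subray of `η` starting at u is itself Morse, so the partner w of γ s' satisfies w ≥ u ≥ u'.
  -- As γ s' is also near η u', the difference w - u' is bounded, and hence so is u - u'.
  obtain ⟨_, ⟨w, hw, rfl⟩, hwC⟩ := hC (hM _ isClosed_Ici Set.ordConnected_Ici)
    (isGeodesicOn_of_isometry hγ (Set.Ici s)) isClosed_Ici Set.ordConnected_Ici
    (t₁ := s) (t₂ := t₂) (D := D) (v := η r) Set.self_mem_Ici
    (by rw [Set.mem_Ici]; linarith) ⟨η u, ⟨u, Set.self_mem_Ici, rfl⟩, hsu⟩ ⟨r, hru, rfl⟩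
    (by rwa [dist_comm]) s' ⟨hs, by linarith⟩
  have e1 := hη.dist_eq w u'
  have e2 := hη.dist_eq u u'
  have hwu : u ≤ w := hw
  rw [Real.dist_eq, abs_of_nonneg (by linarith)] at e1 e2
  have e3 := dist_triangle4 (η w) (γ s') x' (η u')
  rw [dist_comm (η w) (γ s'), dist_comm (γ s') x'] at e3
  have e4 := dist_triangle4 x (η u) (η u') x'
  rw [dist_comm (η u') x'] at e4
  linarith

/-- Coarse uniqueness of the center of an ideal triangle with Morse sides. -/
theorem exists_dist_le_of_near_sides (hX : IsGeodesicSpace X) (N : MorseGauge) (K : ℝ) :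
    ∃ C : ℝ, ∀ {p : X} {a b c : MorseBoundary p} {γ₁ γ₂ γ₃ : ℝ → X},
      IsIdealTriangle a b c γ₁ γ₂ γ₃ → IsMorseLine N γ₂ → IsMorseLine N γ₃ →
      ∀ {x x' : X}, (∃ t, dist x (γ₁ t) ≤ K) → (∃ t, dist x (γ₂ t) ≤ K) →
      (∃ t, dist x (γ₃ t) ≤ K) → (∃ t, dist x' (γ₁ t) ≤ K) → (∃ t, dist x' (γ₂ t) ≤ K) →
      (∃ t, dist x' (γ₃ t) ≤ K) → dist x x' ≤ C := by
  obtain ⟨C, hC⟩ := exists_dist_le_of_opposite hX N K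
  refine ⟨C, ?_⟩
  rintro p a b c γ₁ γ₂ γ₃ ⟨⟨hγ₁, h₁a, h₁b⟩, ⟨hγ₂, h₂b, h₂c⟩, ⟨hγ₃, h₃a, h₃c⟩⟩ hM₂ hM₃ x x'
    ⟨s, hs⟩ ⟨u, hu⟩ ⟨w, hw⟩ ⟨s', hs'⟩ ⟨u', hu'⟩ ⟨w', hw'⟩
  have ha : Asymptotic ((fun t => γ₁ (-t)) '' Set.Ici 0) ((fun t => γ₃ (-t)) '' Set.Ici 0) := by
    rw [image_comp_neg_Ici, image_comp_neg_Ici]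
    exact asymptotic_of_rays h₁a h₃a
  have hb : Asymptotic (γ₁ '' Set.Ici 0) ((fun t => γ₂ (-t)) '' Set.Ici 0) := by
    rw [image_comp_neg_Ici]
    exact asymptotic_of_rays h₁b h₂b
  have hc : Asymptotic (γ₂ '' Set.Ici 0) (γ₃ '' Set.Ici 0) := asymptotic_of_rays h₂c h₃c
  have ka : ∀ {s s' w w' : ℝ} {x x' : X}, dist x (γ₁ s) ≤ K → dist x (γ₃ w) ≤ K →
      dist x' (γ₁ s') ≤ K → dist x' (γ₃ w') ≤ K → s' ≤ s → w ≤ w' → dist x x' ≤ C := by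
    intro s s' w w' x x' h1 h2 h3 h4 h5 h6
    exact hC (isometry_comp_neg hγ₁) (isometry_comp_neg hγ₃) hM₃.comp_neg ha
      (s := -s) (s' := -s') (u := -w) (u' := -w') (by rwa [neg_neg]) (by rwa [neg_neg])
      (by rwa [neg_neg]) (by rwa [neg_neg]) (neg_le_neg h5) (neg_le_neg h6)
  have kb : ∀ {s s' u u' : ℝ} {x x' : X}, dist x (γ₁ s) ≤ K → dist x (γ₂ u) ≤ K →
      dist x' (γ₁ s') ≤ K → dist x' (γ₂ u') ≤ K → s ≤ s' → u ≤ u' → dist x x' ≤ C := by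
    intro s s' u u' x x' h1 h2 h3 h4 h5 h6
    exact hC hγ₁ (isometry_comp_neg hγ₂) hM₂.comp_neg hb (u := -u) (u' := -u') h1
      (by rwa [neg_neg]) h3 (by rwa [neg_neg]) h5 (neg_le_neg h6)
  -- The sides run a→b, b→c and a→c. Opposite orders towards b mean that s and u change in the same
  -- direction; at a and c they mean that s, w and u, w, respectively, change in opposite
  -- directions. If s and u change in opposite directions, w is opposite to one of them.
  rcases le_total s s' with h1 | h1 <;> rcases le_total u u' with h2 | h2 <;>
    rcases le_total w w' with h3 | h3
  · exact kb hs hu hs' hu' h1 h2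
  · exact kb hs hu hs' hu' h1 h2
  · rw [dist_comm]; exact hC hγ₂ hγ₃ hM₃ hc hu' hw' hu hw h2 h3
  · rw [dist_comm]; exact ka hs' hw' hs hw h1 h3
  · exact ka hs hw hs' hw' h1 h3
  · exact hC hγ₂ hγ₃ hM₃ hc hu hw hu' hw' h2 h3
  · rw [dist_comm]; exact kb hs' hu' hs hu h1 h2
  · rw [dist_comm]; exact kb hs' hu' hs hu h1 h2

end Triangles

/-! ### The induced boundary map and its continuity -/

section BoundaryMap

variable {X Y : Type*} [MetricSpace X] [MetricSpace Y] {p : X} {q : Y}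

theorem Ray.exists_cls_eq (a : VisualBoundary p) : ∃ α : Ray p, α.cls = a :=
  Quotient.exists_rep a

theorem IsInducedBy.refl : IsInducedBy (fun x : X => x) (fun a : MorseBoundary p => a) := by
  intro a α β hα hβ
  rw [Set.image_id']
  exact Ray.cls_eq_iff.1 (hα.trans hβ.symm)

/-- The image class is determined by testing a single pair of representatives. -/
theorem IsInducedBy.eq_cls {f : X → Y} {h : MorseBoundary p → MorseBoundary q}
    (hfh : IsInducedBy f h) {a : MorseBoundary p} {α : Ray p} {β : Ray q} (hα : α.cls = a.1)
    (hαβ : Asymptotic (f '' α.image) β.image) : (h a).1 = β.cls := by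
  obtain ⟨β', hβ'⟩ := Ray.exists_cls_eq (h a).1
  rw [← hβ', Ray.cls_eq_iff]
  exact (hfh a α β' hα hβ').symm.trans hαβ

/-- A quasi-isometry induces a map between the Morse boundaries. -/
theorem IsQuasiIsometry.exists_isInducedBy [ProperSpace Y] (hY : IsGeodesicSpace Y) {f : X → Y}
    (hf : IsQuasiIsometry f) (p : X) (q : Y) :
    ∃ h : MorseBoundary p → MorseBoundary q, IsInducedBy f h := by
  have hex : ∀ a : MorseBoundary p, ∃ b : MorseBoundary q, ∃ (α : Ray p) (β : Ray q),
      α.cls = a.1 ∧ β.cls = b.1 ∧ Asymptotic (f '' α.image) β.image := by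
    rintro ⟨_, N, α, rfl, hα⟩
    obtain ⟨N', C, hC⟩ := hf.exists_ray hY p q N
    obtain ⟨β, hβ, hαβ⟩ := hC α hα
    exact ⟨⟨β.cls, N', β, rfl, hβ⟩, α, β, rfl, rfl, hαβ.asymptotic⟩
  choose h α β hα hβ hαβ using hex
  refine ⟨h, fun a α' β' hα' hβ' => ?_⟩
  have h1 := (Ray.cls_eq_iff.1 (hα'.trans (hα a).symm)).image hf
  exact h1.trans ((hαβ a).trans (Ray.cls_eq_iff.1 ((hβ a).trans hβ'.symm)))

theorem IsInducedBy.leftInverse {f : X → Y} {g : Y → X} (hg : IsQuasiIsometry g)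
    {h : MorseBoundary p → MorseBoundary q} {k : MorseBoundary q → MorseBoundary p}
    (hfh : IsInducedBy f h) (hgk : IsInducedBy g k) {D : ℝ} (hD : ∀ x, dist (g (f x)) x ≤ D) :
    Function.LeftInverse k h := by
  intro a
  obtain ⟨α, hα⟩ := Ray.exists_cls_eq a.1
  obtain ⟨β, hβ⟩ := Ray.exists_cls_eq (h a).1
  refine Subtype.ext ?_
  rw [hgk.eq_cls hβ (β := α) ?_, hα]
  refine ((hfh a α β hα hβ).symm.image hg).trans (CoarselyClose.asymptotic (C := D) ⟨?_, ?_⟩)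
  · rintro _ ⟨_, ⟨x, hx, rfl⟩, rfl⟩
    exact ⟨x, hx, hD x⟩
  · intro x hx
    exact ⟨_, ⟨_, ⟨x, hx, rfl⟩, rfl⟩, by rw [dist_comm]; exact hD x⟩

theorem isClosed_iff_isVisuallyClosed {B : Set (VisualBoundary p)} :
    IsClosed B ↔ IsVisuallyClosed B := by
  rw [← isOpen_compl_iff]
  change Bᶜᶜ ∈ {B : Set (VisualBoundary p) | IsVisuallyClosed B} ↔ _
  rw [compl_compl]
  rfl

theorem continuous_stratumInclusion (p : X) (N : MorseGauge) :
    Continuous (stratumInclusion p N) :=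
  continuous_iSup_rng continuous_coinduced_rng

/-- The map between the Morse boundaries induced by a quasi-isometry is continuous. -/
theorem IsInducedBy.continuous [ProperSpace X] [ProperSpace Y] (hX : IsGeodesicSpace X)
    (hY : IsGeodesicSpace Y) {f : X → Y} (hf : IsQuasiIsometry f)
    {h : MorseBoundary p → MorseBoundary q} (hfh : IsInducedBy f h) : Continuous h := by
  refine continuous_iSup_dom.2 fun N => continuous_coinduced_dom.2 ?_
  rw [continuous_iff_isClosed]
  intro F hF
  obtain ⟨M, hM⟩ := exists_gauge_limitRays p N
  obtain ⟨K, hK0, hK⟩ := Ray.exists_dist_le_of_asymptotic hX M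
  obtain ⟨N', C, hC⟩ := hf.exists_ray hY p q M
  -- All rays in `limitRays p N` are sent into the single stratum of gauge `N'`, where `F` is the
  -- trace of a visually closed set.
  obtain ⟨F', hF', hFF'⟩ := isClosed_induced_iff.1 (hF.preimage (continuous_stratumInclusion q N'))
  rw [isClosed_iff_isVisuallyClosed] at hF'
  have hmem : ∀ (b : MorseBoundary q) (hb : b.1 ∈ stratum q N'), b.1 ∈ F' ↔ b ∈ F := by
    intro b hb
    have := Set.ext_iff.1 hFF' ⟨b.1, hb⟩
    exact this
  -- The witness uses all limit classes, not only the stratum: this larger set is visually closed,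
  -- and its trace on the stratum is the required preimage.
  refine isClosed_induced_iff.2 ⟨{x | x ∈ Ray.cls '' limitRays p N ∧ ∃ m, h ⟨x, m⟩ ∈ F}, ?_, ?_⟩
  · rw [isClosed_iff_isVisuallyClosed]
    intro β b hβ hb
    have hbS := isVisuallyClosed_limitRays hX p N β b (fun n => (hβ n).1) hb
    have hbm : ∃ m : MorseGauge, b ∈ stratum p m := by
      obtain ⟨α, hα, rfl⟩ := hbS
      exact ⟨M, α, rfl, hM α hα⟩
    refine ⟨hbS, hbm, ?_⟩
    choose α hα hαβ using fun n => (hβ n).1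
    choose m hmF using fun n => (hβ n).2
    obtain ⟨⟨l, e, hl, he, hle⟩, -⟩ := id hf
    -- The ray β n is only asymptotic to an `M`-Morse ray α n, so the uniform constant comes from
    -- the image of α n plus the distortion of K.
    have hδ : ∀ n, ∃ δ : Ray q, IsMorse N' δ.image ∧
        CoarselyClose (l * K + e + C) (f '' (β n).image) δ.image := by
      intro n
      obtain ⟨δ, hδ, hδC⟩ := hC (α n) (hM _ (hα n))
      refine ⟨δ, hδ, CoarselyClose.trans (CoarselyClose.image (by linarith)
        (fun x x' => (hle x trivial x' trivial).2) ?_) hδC⟩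
      have h := hK (hM _ (hα n)) (Ray.cls_eq_iff.1 (hαβ n))
      constructor
      · rintro _ ⟨t, rfl⟩
        exact ⟨_, ⟨t, rfl⟩, by rw [dist_comm]; exact h t⟩
      · rintro _ ⟨t, rfl⟩
        exact ⟨_, ⟨t, rfl⟩, h t⟩
    choose δ hδM hδC using hδ
    have hδcls : ∀ n, (h ⟨(β n).cls, m n⟩).1 = (δ n).cls := fun n =>
      hfh.eq_cls rfl (hδC n).asymptotic
    have hδF : ∀ n, (δ n).cls ∈ F' := by
      intro n
      rw [← hδcls n, hmem _ ⟨δ n, (hδcls n).symm, hδM n⟩]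
      exact hmF n
    have hbst : (h ⟨b, hbm⟩).1 ∈ stratum q N' := by
      obtain ⟨α, hα, hαb⟩ := hbS
      obtain ⟨δ, hδ, hδC⟩ := hC α (hM _ hα)
      exact ⟨δ, (hfh.eq_cls hαb hδC.asymptotic).symm, hδ⟩
    rw [← hmem _ hbst]
    refine hF' δ _ hδF fun φ hφ => ?_
    obtain ⟨ψ, hψ, γ, hγb, hγ⟩ := hb φ hφ
    obtain ⟨θ, hθ, η, hη⟩ := Ray.exists_subseq_tendsto fun n => δ (φ (ψ n))
    refine ⟨fun n => ψ (θ n), hψ.comp hθ, η, ?_, hη⟩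
    exact (hfh.eq_cls (a := ⟨b, hbm⟩) hγb
      (hf.asymptotic_of_rayTendsto (fun n => hδC _) (hγ.comp hθ) hη)).symm
  · ext ⟨x, hx⟩
    constructor
    · rintro ⟨-, m, hm⟩
      exact hm
    · intro hxF
      obtain ⟨α, hα, hαN⟩ := id hx
      refine ⟨⟨α, fun R ε hε => ⟨α, hαN, fun t _ => ?_⟩, hα⟩, ⟨N, hx⟩, hxF⟩
      rw [dist_self]
      exact hε.le

end BoundaryMap

/-! ### 2-stability and cross-ratios -/

section CrossRatio

variable {X Y : Type*} [MetricSpace X] [MetricSpace Y] {p : X} {q : Y}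

/-- A line joining the image points is compared with a line joining the original points; one exists
because these are distinct, and it is `N`-Morse by assumption. -/
theorem IsInducedBy.isTwoStable [ProperSpace X] (hX : IsGeodesicSpace X) (hY : IsGeodesicSpace Y)
    {f : X → Y} (hf : IsQuasiIsometry f) {h : MorseBoundary p → MorseBoundary q}
    (hfh : IsInducedBy f h) (hinj : Function.Injective h) : IsTwoStable h := by
  intro N
  obtain ⟨C, N', hC⟩ := hfh.exists_coarselyClose_line hY hf N
  refine ⟨N', fun t ht => ⟨hinj.comp ht.1, fun i j hij η hη => ?_⟩⟩
  obtain ⟨γ, hγ⟩ := exists_isLineFromTo hX (ht.1.ne hij)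
  exact (hC hγ (ht.2 i j hij γ hγ) hη).2

/-- The image of a center is uniformly close to all centers of the image points. -/
theorem IsInducedBy.exists_dist_le_centers (hY : IsGeodesicSpace Y) {f : X → Y}
    (hf : IsQuasiIsometry f) {h : MorseBoundary p → MorseBoundary q} (hfh : IsInducedBy f h)
    (N : MorseGauge) (K K' : ℝ) :
    ∃ C : ℝ, 0 ≤ C ∧ ∀ {n : ℕ} {t : Fin n → MorseBoundary p}, t ∈ morseTuples p n N →
      ∀ {i j k : Fin n}, i ≠ j → j ≠ k → i ≠ k → ∀ x ∈ centers K (t i) (t j) (t k),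
      ∀ y ∈ centers K' (h (t i)) (h (t j)) (h (t k)), dist (f x) y ≤ C := by
  obtain ⟨C, N', hC⟩ := hfh.exists_coarselyClose_line hY hf N
  obtain ⟨⟨l, e, hl, he, hle⟩, -⟩ := id hf
  obtain ⟨C', hC'⟩ := exists_dist_le_of_near_sides hY N' (max K' (l * K + e + C))
  refine ⟨max C' 0, le_max_right _ _, ?_⟩
  rintro n t ht i j k hij hjk hik x ⟨γ₁, γ₂, γ₃, ⟨h₁, h₂, h₃⟩, hx₁, hx₂, hx₃⟩ y
    ⟨η₁, η₂, η₃, hη, hy₁, hy₂, hy₃⟩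
  have hmono : ∀ η : ℝ → Y, (∃ t, dist y (η t) ≤ K') →
      ∃ t, dist y (η t) ≤ max K' (l * K + e + C) :=
    fun η ⟨t, ht⟩ => ⟨t, ht.trans (le_max_left _ _)⟩
  have himage : ∀ (γ : ℝ → X) (η : ℝ → Y), CoarselyClose C (f '' Set.range γ) (Set.range η) →
      (∃ t, dist x (γ t) ≤ K) → ∃ t, dist (f x) (η t) ≤ max K' (l * K + e + C) := by
    rintro γ η hγη ⟨t, ht⟩
    obtain ⟨_, ⟨s, rfl⟩, hs⟩ := hγη.1 _ ⟨_, ⟨t, rfl⟩, rfl⟩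
    refine ⟨s, le_trans ?_ (le_max_right _ _)⟩
    have e1 := (hle x trivial (γ t) trivial).2
    have e2 : l * dist x (γ t) ≤ l * K := mul_le_mul_of_nonneg_left ht (by linarith)
    linarith [dist_triangle (f x) (f (γ t)) (η s)]
  obtain ⟨c₁, m₁⟩ := hC h₁ (ht.2 i j hij _ h₁) hη.1
  obtain ⟨c₂, m₂⟩ := hC h₂ (ht.2 j k hjk _ h₂) hη.2.1
  obtain ⟨c₃, m₃⟩ := hC h₃ (ht.2 i k hik _ h₃) hη.2.2
  exact (hC' hη m₂ m₃ (himage _ _ c₁ hx₁) (himage _ _ c₂ hx₂) (himage _ _ c₃ hx₃) (hmono _ hy₁)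
    (hmono _ hy₂) (hmono _ hy₃)).trans (le_max_left _ _)

theorem IsInternalConstant.centers_nonempty [ProperSpace X] (hX : IsGeodesicSpace X)
    {N : MorseGauge} {K : ℝ} (hK : IsInternalConstant p N K) {n : ℕ}
    {t : Fin n → MorseBoundary p} (ht : t ∈ morseTuples p n N) {i j k : Fin n} (hij : i ≠ j)
    (hjk : j ≠ k) (hik : i ≠ k) : (centers K (t i) (t j) (t k)).Nonempty := by
  obtain ⟨γ₁, h₁⟩ := exists_isLineFromTo hX (ht.1.ne hij)
  obtain ⟨γ₂, h₂⟩ := exists_isLineFromTo hX (ht.1.ne hjk)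
  obtain ⟨γ₃, h₃⟩ := exists_isLineFromTo hX (ht.1.ne hik)
  obtain ⟨t₁, t₂, t₃, e₁, -, e₃⟩ := hK.2 _ _ _ γ₁ γ₂ γ₃ ⟨h₁, h₂, h₃⟩ (ht.2 i j hij _ h₁)
    (ht.2 j k hjk _ h₂) (ht.2 i k hik _ h₃)
  exact ⟨γ₁ t₁, γ₁, γ₂, γ₃, ⟨h₁, h₂, h₃⟩, ⟨t₁, by rw [dist_self]; exact hK.1.le⟩, ⟨t₂, e₁⟩, t₃, e₃⟩

theorem IsInducedBy.isQuasiMobius [ProperSpace X] (hX : IsGeodesicSpace X)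
    (hY : IsGeodesicSpace Y) {f : X → Y} (hf : IsQuasiIsometry f)
    {h : MorseBoundary p → MorseBoundary q} (hfh : IsInducedBy f h) : IsQuasiMobius h := by
  intro N N' _ K K' hK _
  -- For the identity map, the comparison of centers says that the centers of one triple form a
  -- bounded set; this makes the cross-ratio in X finite.
  obtain ⟨C₀, hC₀, hX'⟩ := IsInducedBy.refl.exists_dist_le_centers (p := p) hX IsQuasiIsometry.refl N K K
  obtain ⟨C, hC0, hC⟩ := hfh.exists_dist_le_centers hY hf N K K'
  obtain ⟨⟨l, e, hl, he, hle⟩, -⟩ := id hf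
  have hl0 : (0 : ℝ) < l := by linarith
  obtain ⟨m, rfl⟩ : ∃ m : ℝ≥0, (m : ℝ) = l := ⟨⟨l, hl0.le⟩, rfl⟩
  -- Each center of an image triple is within C of the image of a center, which adds 2C to the
  -- diameter besides the error e of f.
  obtain ⟨c, hc⟩ : ∃ c : ℝ≥0, (c : ℝ) = e + 2 * C := ⟨⟨e + 2 * C, by positivity⟩, rfl⟩
  refine ⟨fun r => m * r + c, by fun_prop, fun r s hrs => ?_, ?_⟩
  · have hm : 0 < m := NNReal.coe_pos.1 hl0
    dsimp only
    gcongr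
  intro t ht
  have h01 : (0 : Fin 4) ≠ 1 := by decide
  have h12 : (1 : Fin 4) ≠ 2 := by decide
  have h02 : (0 : Fin 4) ≠ 2 := by decide
  have h03 : (0 : Fin 4) ≠ 3 := by decide
  have h32 : (3 : Fin 4) ≠ 2 := by decide
  obtain ⟨x₁, hx₁⟩ := hK.centers_nonempty hX ht h01 h12 h02
  obtain ⟨x₂, hx₂⟩ := hK.centers_nonempty hX ht h03 h32 h02
  set U := centers K (t 0) (t 1) (t 2) ∪ centers K (t 0) (t 3) (t 2) with hU
  have hUfin : Metric.ediam U ≠ ⊤ := by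
    have hnear : ∀ x ∈ U, dist x x₁ ≤ C₀ + dist x₁ x₂ := by
      rintro x (hx | hx)
      · linarith [hX' ht h01 h12 h02 x hx x₁ hx₁, dist_nonneg (x := x₁) (y := x₂)]
      · have := hX' ht h03 h32 h02 x hx x₂ hx₂
        have h' := dist_triangle x x₂ x₁
        rw [dist_comm x₂ x₁] at h'
        linarith
    refine ne_top_of_le_ne_top (ENNReal.ofReal_ne_top (r := 2 * (C₀ + dist x₁ x₂)))
      (Metric.ediam_le fun x hx y hy => ?_)
    rw [edist_dist]
    refine ENNReal.ofReal_le_ofReal ?_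
    have := dist_triangle x x₁ y
    rw [dist_comm x₁ y] at this
    linarith [hnear x hx, hnear y hy]
  obtain ⟨r, hr⟩ := WithTop.ne_top_iff_exists.1 hUfin
  change (r : ℝ≥0∞) = _ at hr
  have hUr : ∀ x ∈ U, ∀ y ∈ U, dist x y ≤ r := by
    intro x hx y hy
    have := Metric.edist_le_ediam_of_mem hx hy
    rw [← hr, edist_nndist, ENNReal.coe_le_coe] at this
    exact this
  set V := centers K' (h (t 0)) (h (t 1)) (h (t 2)) ∪ centers K' (h (t 0)) (h (t 3)) (h (t 2))
  have hnear : ∀ y ∈ V, ∃ x ∈ U, dist (f x) y ≤ C := by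
    rintro y (hy | hy)
    · exact ⟨x₁, Or.inl hx₁, hC ht h01 h12 h02 x₁ hx₁ y hy⟩
    · exact ⟨x₂, Or.inr hx₂, hC ht h03 h32 h02 x₂ hx₂ y hy⟩
  have hV : Metric.ediam V ≤ ((m * r + c : ℝ≥0) : ℝ≥0∞) := by
    refine Metric.ediam_le fun y hy y' hy' => ?_
    rw [edist_nndist, ENNReal.coe_le_coe, ← NNReal.coe_le_coe, coe_nndist, NNReal.coe_add,
      NNReal.coe_mul, hc]
    obtain ⟨x, hx, hxy⟩ := hnear y hy
    obtain ⟨x', hx', hxy'⟩ := hnear y' hy'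
    have e1 := (hle x trivial x' trivial).2
    have e2 : m * dist x x' ≤ m * r := mul_le_mul_of_nonneg_left (hUr x hx x' hx') hl0.le
    have e3 := dist_triangle4 y (f x) (f x') y'
    rw [dist_comm y (f x)] at e3
    linarith
  obtain ⟨s, hs⟩ := WithTop.ne_top_iff_exists.1 (ne_top_of_le_ne_top ENNReal.coe_ne_top hV)
  change (s : ℝ≥0∞) = _ at hs
  refine ⟨r, s, hr.symm, hs.symm, ?_⟩
  rwa [← hs, ENNReal.coe_le_coe] at hV

end CrossRatio

end MorseGeometry

/-! ### The theorem, with the inverse map coming from a quasi-inverse -/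

open MorseGeometry
theorem theorem4p1 {X : Type*} {Y : Type*} [MetricSpace X] [ProperSpace X]
    [MetricSpace Y] [ProperSpace Y]
    (hX : IsGeodesicSpace X) (hY : IsGeodesicSpace Y)
    (f : X → Y) (hf : IsQuasiIsometry f) (p : X) (q : Y) :
    (∀ N : MorseGauge, ∃ K : ℝ, IsInternalConstant p N K) ∧
    (∀ N : MorseGauge, ∃ K : ℝ, IsInternalConstant q N K) ∧
    ∃ h : MorseBoundary p ≃ₜ MorseBoundary q,
      IsInducedBy f h ∧
      IsTwoStable h ∧ IsQuasiMobius h ∧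
      IsTwoStable h.symm ∧ IsQuasiMobius h.symm := by
  obtain ⟨g, hg, D, -, hgf, hfg⟩ := hf.exists_inverse
  obtain ⟨h, hfh⟩ := hf.exists_isInducedBy hY p q
  obtain ⟨k, hgk⟩ := hg.exists_isInducedBy hX q p
  have hkh : Function.LeftInverse k h := hfh.leftInverse hg hgk hgf
  have hhk : Function.LeftInverse h k := hgk.leftInverse hf hfh hfg
  exact ⟨exists_isInternalConstant hX p, exists_isInternalConstant hY q,
    { toFun := h
      invFun := k
      left_inv := hkh
      right_inv := hhk
      continuous_toFun := hfh.continuous hX hY hf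
      continuous_invFun := hgk.continuous hY hX hg },
    hfh, hfh.isTwoStable hX hY hf hkh.injective, hfh.isQuasiMobius hX hY hf,
    hgk.isTwoStable hY hX hg hhk.injective, hgk.isQuasiMobius hY hX hg⟩
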